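/- Let $\mathbb{K}$ be an algebraically closed field of characteristic zero. Let $M\cong\mathbb{Z}^2$ be the character lattice of the torus $\mathbb{G}_m^2$, with dual lattice $N$, pairing $\langle\cdot,\cdot\rangle$ and $M_{\mathbb{Q}}=M\otimes\mathbb{Q}$, $N_{\mathbb{Q}}=N\otimes\mathbb{Q}$. Let $\sigma\subset N_{\mathbb{Q}}$ be a rational strongly convex two-dimensional cone with ray generators $p_1,p_2$ (the primitive lattice vectors on its two edges), let $\sigma^\vee\subset M_{\mathbb{Q}}$ be the dual cone, and let $Z_\sigma=\operatorname{Spec}\mathbb{K}[\sigma^\vee\cap M]$ be the corresponding normal affine toric surface. For $u\in M$ let $\chi^u$ be the corresponding character. A Demazure root associated to $p_i$ is an element $e\in M$ with $\langle e,p_i\rangle=-1$ and $\langle e,p_j\rangle\ge 0$ for $j\ne i$. An ordered pair $(e_1,e_2)$ of (possibly equal) Demazure roots associated to one and the same ray generator $p_i$ defines on $Z_\sigma$ the structure of an affine algebraic monoid, that is, a bialgebra structure on $\mathbb{K}[Z_\sigma]=\mathbb{K}[\sigma^\vee\cap M]$, whose comultiplication is $$\chi^u\mapsto \chi^u\otimes\chi^u\,(1\otimes\chi^{e_1}+\chi^{e_2}\otimes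 1)^{\langle u,p_i\rangle},\qquad u\in\sigma^\vee\cap M,$$ and whose counit sends $\chi^u$ to $1$ if $\langle u,p_i\rangle=0$ and to $0$ otherwise. Two monoid structures on $Z_\sigma$ are called isomorphic if they are isomorphic as algebraic monoids, equivalently, if the two bialgebras are isomorphic. Let $\widehat\tau\colon M_{\mathbb{Q}}\to M_{\mathbb{Q}}$ be the linear map which swaps the two ray generators of $\sigma^\vee$. 1. If $\widehat\tau(M)\ne M$, then the monoid structures on $Z_\sigma$ given by different pairs $(e_1,e_2)$ are pairwise non-isomorphic. 2. If $\widehat\tau(M)=M$, then for every pair $(e_1,e_2)$ of Demazure roots associated to one ray generator, $(\widehat\tau(e_1),\widehat\tau(e_2))$ is again such a pair, and the monoid structures given by two such pairs $(e_1,e_2)$ and $(e_1',e_2')$ are isomorphic if and only if $(e_1',e_2')=(e_1,e_2)$ or $(e_1',e_2')=(\widehat\tau(e_1),\widehat\tau(e_2))$. -/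

import Mathlib

open scoped TensorProduct

namespace ToricSurface

/-- The lattice `ℤ²`. It serves both as the character lattice `M` of the torus `𝔾ₘ²` and as the dual
lattice `N` of one-parameter subgroups; the pairing `⟨u, v⟩` is the dot product `u ⬝ᵥ v`. -/
abbrev Lat : Type := Fin 2 → ℤ

/-- The rational vector space `ℚ² = ℤ² ⊗ ℚ` (both `M_ℚ` and `N_ℚ`). -/
abbrev LatQ : Type := Fin 2 → ℚ

/-- The inclusion of the lattice `ℤ²` in `ℚ²`. -/
def toQ : Lat →+ LatQ where
  toFun u := fun i => (u i : ℚ)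
  map_zero' := by ext; simp
  map_add' u v := by ext; simp

/-- The dual cone `{w | ⟨w, v⟩ ≥ 0 for all v ∈ σ}`. -/
def dualCone (σ : PointedCone ℚ LatQ) : PointedCone ℚ LatQ :=
  PointedCone.dual (dotProductBilin ℚ ℚ) (σ : Set LatQ)

/-- `p` is a ray generator of the cone `σ`: a primitive lattice vector such that the ray
`ℚ_{≥0} p` is an edge (a one-dimensional face) of `σ`. -/
structure IsRayGenerator (σ : PointedCone ℚ LatQ) (p : Lat) : Prop where
  primitive : IsCoprime (p 0) (p 1)
  isFaceOf : (PointedCone.hull ℚ {toQ p}).IsFaceOf σ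

/-- A rational strongly convex two-dimensional cone in `N_ℚ`. (Over `ℚ`, rational polyhedral means
finitely generated.) -/
structure SurfaceCone where
  cone : PointedCone ℚ LatQ
  fg : cone.FG
  salient : (cone : ConvexCone ℚ LatQ).Salient
  span_eq_top : Submodule.span ℚ (cone : Set LatQ) = ⊤

/-- For a ray generator `p` of `σ`, the vector `e` of `M` is a Demazure root of `σ` associated
to `p`. -/
structure IsDemazureRoot (σ : SurfaceCone) (p e : Lat) : Prop where
  isRayGenerator : IsRayGenerator σ.cone p
  pairing_eq : e ⬝ᵥ p = -1
  pairing_nonneg : ∀ q : Lat, IsRayGenerator σ.cone q → q ≠ p → 0 ≤ e ⬝ᵥ q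

/-- An ordered pair `(e₁, e₂)` of Demazure roots of `σ` associated to one and the same ray
generator `p` of `σ`. -/
structure DemazurePair (σ : SurfaceCone) where
  p : Lat
  e₁ : Lat
  e₂ : Lat
  root₁ : IsDemazureRoot σ p e₁
  root₂ : IsDemazureRoot σ p e₂

/-- The monoid `σ^∨ ∩ M`. -/
def charMonoid (σ : SurfaceCone) : AddSubmonoid Lat :=
  (dualCone σ.cone).toAddSubmonoid.comap toQ

/-! ### A strongly convex cone is generated by its ray generators -/

theorem toQ_apply (u : Lat) (i : Fin 2) : toQ u i = (u i : ℚ) := rfl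

theorem toQ_dotProduct (u v : Lat) : toQ u ⬝ᵥ toQ v = ((u ⬝ᵥ v : ℤ) : ℚ) := by
  simp [dotProduct, toQ_apply]

theorem mem_charMonoid {σ : SurfaceCone} {u : Lat} :
    u ∈ charMonoid σ ↔ ∀ v ∈ σ.cone, 0 ≤ v ⬝ᵥ toQ u := Iff.rfl

theorem mem_ray {x y : LatQ} :
    y ∈ PointedCone.hull ℚ {x} ↔ ∃ c : ℚ, 0 ≤ c ∧ c • x = y := by
  rw [PointedCone.hull, Submodule.mem_span_singleton]
  constructor
  · rintro ⟨c, rfl⟩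
    exact ⟨c.1, c.2, rfl⟩
  · rintro ⟨c, hc, rfl⟩
    exact ⟨⟨c, hc⟩, rfl⟩

theorem exists_primitive {x : LatQ} (hx : x ≠ 0) :
    ∃ p : Lat, IsCoprime (p 0) (p 1) ∧ ∃ c : ℚ, 0 < c ∧ x = c • toQ p := by
  obtain ⟨z, d, hd, hz⟩ : ∃ z : Lat, ∃ d : ℚ, 0 < d ∧ x = d • toQ z := by
    refine ⟨![(x 0).num * (x 1).den, (x 1).num * (x 0).den],
      ((x 0).den * (x 1).den : ℚ)⁻¹, ?_, ?_⟩
    · have h0 := (x 0).den_pos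
      have h1 := (x 1).den_pos
      positivity
    · have h0 : ((x 0).den : ℚ) ≠ 0 := by exact_mod_cast (x 0).den_nz
      have h1 : ((x 1).den : ℚ) ≠ 0 := by exact_mod_cast (x 1).den_nz
      have e0 := Rat.mul_den_eq_num (x 0)
      have e1 := Rat.mul_den_eq_num (x 1)
      ext i
      fin_cases i
      · simp [toQ_apply]
        field_simp
        linarith
      · simp [toQ_apply]
        field_simp
        linarith
  have hz0 : z 0 ≠ 0 ∨ z 1 ≠ 0 := by
    by_contra! h
    apply hx
    rw [hz]
    ext i
    fin_cases i <;> simp [toQ_apply, h.1, h.2]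
  have hg : 0 < Int.gcd (z 0) (z 1) := Int.gcd_pos_iff.2 hz0
  obtain ⟨a, b, hab, ha, hb⟩ := Int.exists_gcd_one hg
  refine ⟨![a, b], by simpa [Int.isCoprime_iff_gcd_eq_one] using hab,
    d * (Int.gcd (z 0) (z 1) : ℚ), by positivity, ?_⟩
  rw [hz]
  have ha' : (z 0 : ℚ) = a * (Int.gcd (z 0) (z 1) : ℚ) := by exact_mod_cast ha
  have hb' : (z 1 : ℚ) = b * (Int.gcd (z 0) (z 1) : ℚ) := by exact_mod_cast hb
  ext i
  fin_cases i
  · change d * (z 0 : ℚ) = d * (Int.gcd (z 0) (z 1) : ℚ) * (a : ℚ)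
    rw [ha']; ring
  · change d * (z 1 : ℚ) = d * (Int.gcd (z 0) (z 1) : ℚ) * (b : ℚ)
    rw [hb']; ring

theorem cone_eq_hull_rays (σ : SurfaceCone) :
    σ.cone = PointedCone.hull ℚ (toQ '' {p | IsRayGenerator σ.cone p}) := by
  classical
  have hsal : ∀ x y : LatQ, x ∈ σ.cone → y ∈ σ.cone → x + y = 0 → x = 0 := by
    intro x y hx hy hxy
    by_contra h
    refine σ.salient x hx h ?_
    rw [← eq_neg_of_add_eq_zero_right hxy]
    exact hy
  apply le_antisymm
  · have hex : ∃ n : ℕ, ∃ S : Finset LatQ, S.card = n ∧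
        PointedCone.hull ℚ (S : Set LatQ) = σ.cone := by
      obtain ⟨S, hS⟩ := σ.fg
      exact ⟨_, S, rfl, hS⟩
    obtain ⟨S, hcard, hS⟩ := Nat.find_spec hex
    have hmin : ∀ s ∈ S, s ∉ PointedCone.hull ℚ ((S.erase s : Finset LatQ) : Set LatQ) := by
      intro s hs hmem
      refine Nat.find_min hex (m := (S.erase s).card) ?_ ⟨S.erase s, rfl, ?_⟩
      · rw [← hcard]
        exact Finset.card_erase_lt_of_mem hs
      · rw [← hS]
        apply le_antisymm
        · exact Submodule.span_mono (by simp)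
        · refine Submodule.span_le.2 fun t ht => ?_
          by_cases hts : t = s
          · rw [hts]; exact hmem
          · exact Submodule.subset_span (by simp [hts]; simpa using ht)
    have hdec : ∀ s ∈ S, ∀ x ∈ σ.cone, ∃ a : ℚ, 0 ≤ a ∧
        ∃ x' ∈ PointedCone.hull ℚ ((S.erase s : Finset LatQ) : Set LatQ), x = a • s + x' := by
      intro s hs x hx
      rw [← hS, ← Finset.insert_erase hs, Finset.coe_insert, PointedCone.hull,
        Submodule.mem_span_insert] at hx
      obtain ⟨a, z, hz, rfl⟩ := hx
      exact ⟨a.1, a.2, z, by simpa using hz, rfl⟩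
    conv_lhs => rw [← hS]
    refine Submodule.span_le.2 fun s hs => ?_
    have hsS : s ∈ S := hs
    have hle : PointedCone.hull ℚ ((S.erase s : Finset LatQ) : Set LatQ) ≤ σ.cone := by
      rw [← hS]
      exact Submodule.span_mono (by simp)
    have hsσ : s ∈ σ.cone := by rw [← hS]; exact Submodule.subset_span hs
    have hs0 : s ≠ 0 := by
      rintro rfl
      exact hmin 0 hsS (Submodule.zero_mem _)
    obtain ⟨p, hp, c, hc, hsp⟩ := exists_primitive hs0
    have hray : ∀ y, y ∈ PointedCone.hull ℚ {toQ p} ↔ ∃ d : ℚ, 0 ≤ d ∧ d • s = y := by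
      intro y
      rw [mem_ray, hsp]
      constructor
      · rintro ⟨d, hd, rfl⟩
        refine ⟨d / c, by positivity, ?_⟩
        rw [smul_smul, div_mul_cancel₀ _ hc.ne']
      · rintro ⟨d, hd, rfl⟩
        exact ⟨d * c, by positivity, by rw [smul_smul]⟩
    have hpr : IsRayGenerator σ.cone p := by
      refine ⟨hp, ⟨?_, ?_⟩⟩
      · intro y hy
        obtain ⟨d, hd, rfl⟩ := (hray y).1 hy
        exact PointedCone.smul_mem _ hd hsσ
      · intro x y t hx hy ht hxy
        obtain ⟨d, hd, hde⟩ := (hray _).1 hxy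
        obtain ⟨a, ha, x', hx', rfl⟩ := hdec s hsS x hx
        obtain ⟨b, hb, y', hy', rfl⟩ := hdec s hsS y hy
        have key : (d - t * a - b) • s = t • x' + y' := by
          have h1 : (d - t * a - b) • s = d • s - (t * a) • s - b • s := by
            rw [sub_smul, sub_smul]
          rw [h1, hde, smul_add, smul_smul]
          abel
        have hsum : t • x' + y' ∈ PointedCone.hull ℚ ((S.erase s : Finset LatQ) : Set LatQ) :=
          Submodule.add_mem _ (PointedCone.smul_mem _ ht.le hx') hy'
        have hle0 : d - t * a - b ≤ 0 := by
          by_contra! hpos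
          refine hmin s hsS ?_
          rw [← key] at hsum
          exact (PointedCone.smul_mem_iff _ hpos).1 hsum
        have hx0 : t • x' = 0 := by
          refine hsal (t • x') (y' + (-(d - t * a - b)) • s)
            (hle (PointedCone.smul_mem _ ht.le hx'))
            (Submodule.add_mem _ (hle hy')
              (PointedCone.smul_mem _ (by linarith) hsσ)) ?_
          rw [← add_assoc, ← key, neg_smul, add_neg_cancel]
        have hx0' : x' = 0 := (smul_eq_zero.1 hx0).resolve_left ht.ne'
        rw [hray, hx0', add_zero]
        exact ⟨a, ha, rfl⟩
    rw [hsp]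
    exact PointedCone.smul_mem _ hc.le (Submodule.subset_span ⟨p, hpr, rfl⟩)
  · refine Submodule.span_le.2 ?_
    rintro _ ⟨p, hp, rfl⟩
    exact hp.isFaceOf.le (mem_ray.2 ⟨1, zero_le_one, one_smul _ _⟩)

theorem mem_charMonoid_iff {σ : SurfaceCone} {u : Lat} :
    u ∈ charMonoid σ ↔ ∀ q, IsRayGenerator σ.cone q → 0 ≤ u ⬝ᵥ q := by
  rw [mem_charMonoid]
  constructor
  · intro h q hq
    have := h (toQ q) (hq.isFaceOf.le (mem_ray.2 ⟨1, zero_le_one, one_smul _ _⟩))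
    rw [toQ_dotProduct, dotProduct_comm] at this
    exact_mod_cast this
  · intro h v hv
    rw [cone_eq_hull_rays σ] at hv
    induction hv using Submodule.span_induction with
    | mem x hx =>
      obtain ⟨q, hq, rfl⟩ := hx
      rw [toQ_dotProduct, dotProduct_comm]
      exact_mod_cast h q hq
    | zero => simp
    | add x y _ _ hx hy => rw [add_dotProduct]; exact add_nonneg hx hy
    | smul a x _ hx =>
      have : (a • x) ⬝ᵥ toQ u = a.1 * (x ⬝ᵥ toQ u) := smul_dotProduct a.1 x (toQ u)
      rw [this]
      exact mul_nonneg a.2 hx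

namespace DemazurePair

/-- The exponent `⟨u, p⟩` for `u ∈ σ^∨ ∩ M`, as a natural number. -/
def expo {σ : SurfaceCone} (D : DemazurePair σ) (u : charMonoid σ) : ℕ :=
  ((u : Lat) ⬝ᵥ D.p).toNat

theorem expo_cast {σ : SurfaceCone} (D : DemazurePair σ) (u : charMonoid σ) :
    (D.expo u : ℤ) = (u : Lat) ⬝ᵥ D.p :=
  Int.toNat_of_nonneg (mem_charMonoid_iff.1 u.2 _ D.root₁.isRayGenerator)

theorem expo_zero {σ : SurfaceCone} (D : DemazurePair σ) : D.expo 0 = 0 := by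
  simp [expo]

theorem expo_add {σ : SurfaceCone} (D : DemazurePair σ) (u v : charMonoid σ) :
    D.expo (u + v) = D.expo u + D.expo v := by
  zify
  rw [expo_cast, expo_cast, expo_cast, AddSubmonoid.coe_add, add_dotProduct]

theorem add_smul_mem {σ : SurfaceCone} (D : DemazurePair σ) {e : Lat} (he : IsDemazureRoot σ D.p e)
    (u : charMonoid σ) {k : ℕ} (hk : k ≤ D.expo u) : (u : Lat) + k • e ∈ charMonoid σ := by
  rw [mem_charMonoid_iff]
  intro q hq
  rw [add_dotProduct, smul_dotProduct]
  by_cases hqp : q = D.p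
  · have := D.expo_cast u
    rw [hqp, he.pairing_eq, ← this]
    simp
    exact_mod_cast hk
  · have h1 := mem_charMonoid_iff.1 u.2 q hq
    have h2 := he.pairing_nonneg q hq hqp
    positivity

/-- The vector `u + k e₂`, an element of `σ^∨ ∩ M` for `0 ≤ k ≤ ⟨u, p⟩`. -/
def left {σ : SurfaceCone} (D : DemazurePair σ) (u : charMonoid σ) (k : Fin (D.expo u + 1)) :
    charMonoid σ :=
  ⟨(u : Lat) + (k : ℕ) • D.e₂, D.add_smul_mem D.root₂ u (Nat.lt_succ_iff.1 k.2)⟩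

/-- The vector `u + (⟨u, p⟩ - k) e₁`, an element of `σ^∨ ∩ M` for `0 ≤ k ≤ ⟨u, p⟩`. -/
def right {σ : SurfaceCone} (D : DemazurePair σ) (u : charMonoid σ) (k : Fin (D.expo u + 1)) :
    charMonoid σ :=
  ⟨(u : Lat) + (D.expo u - k) • D.e₁, D.add_smul_mem D.root₁ u (Nat.sub_le _ _)⟩

end DemazurePair

/-- The coordinate algebra `K[Z_σ] = K[σ^∨ ∩ M]` of the affine toric surface `Z_σ`. -/
abbrev CoordAlg (K : Type*) [Field K] (σ : SurfaceCone) : Type _ :=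
  AddMonoidAlgebra K (charMonoid σ)

/-- The Laurent polynomial algebra `K[M]`, the coordinate algebra of the torus. -/
abbrev TorusAlg (K : Type*) [Field K] : Type _ := AddMonoidAlgebra K Lat

/-- The character `χ^u ∈ K[Z_σ]` of `u ∈ σ^∨ ∩ M`. -/
noncomputable def chi (K : Type*) [Field K] {σ : SurfaceCone} (u : charMonoid σ) : CoordAlg K σ :=
  AddMonoidAlgebra.single u 1

/-- The character `χ^u ∈ K[M]` of `u ∈ M`. -/
noncomputable def chiT (K : Type*) [Field K] (u : Lat) : TorusAlg K :=
  AddMonoidAlgebra.single u 1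

/-- The inclusion `K[Z_σ] ⊆ K[M]`. -/
noncomputable def incl (K : Type*) [Field K] (σ : SurfaceCone) : CoordAlg K σ →ₐ[K] TorusAlg K :=
  AddMonoidAlgebra.mapDomainAlgHom K K (charMonoid σ).subtype

namespace DemazurePair

/-- The element `Σ_k (m choose k) χ^{u + k e₂} ⊗ χ^{u + (m - k) e₁}`, `m = ⟨u, p⟩`, of
`K[Z_σ] ⊗ K[Z_σ]`, that is `χ^u ⊗ χ^u (1 ⊗ χ^{e₁} + χ^{e₂} ⊗ 1)^{⟨u, p⟩}`
(see `incl_comulChar`). -/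
noncomputable def comulChar (K : Type*) [Field K] {σ : SurfaceCone} (D : DemazurePair σ)
    (u : charMonoid σ) : CoordAlg K σ ⊗[K] CoordAlg K σ :=
  ∑ k : Fin (D.expo u + 1), (D.expo u).choose k • (chi K (D.left u k) ⊗ₜ[K] chi K (D.right u k))

end DemazurePair

section Aux

variable {K : Type*} [Field K] {σ : SurfaceCone} (D : DemazurePair σ)

theorem chiT_add (u v : Lat) : chiT K (u + v) = chiT K u * chiT K v := by
  simp [chiT, AddMonoidAlgebra.single_mul_single]

theorem chiT_zero : chiT K 0 = 1 := rfl

theorem chiT_nsmul (k : ℕ) (u : Lat) : chiT K (k • u) = chiT K u ^ k := by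
  simp [chiT, AddMonoidAlgebra.single_pow]

theorem chi_add (u v : charMonoid σ) : chi K (u + v) = chi K u * chi K v := by
  simp [chi, AddMonoidAlgebra.single_mul_single]

theorem incl_chi (u : charMonoid σ) : incl K σ (chi K u) = chiT K (u : Lat) := by
  simp [incl, chi, chiT]

theorem incl_injective : Function.Injective (incl K σ) :=
  AddMonoidAlgebra.mapDomain_injective Subtype.val_injective

/-- The comultiplication formula
`χ^u ↦ χ^u ⊗ χ^u (1 ⊗ χ^{e₁} + χ^{e₂} ⊗ 1)^{⟨u, p⟩}`, as an identity in `K[M] ⊗ K[M]`. -/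
theorem incl_comulChar (u : charMonoid σ) :
    Algebra.TensorProduct.map (incl K σ) (incl K σ) (D.comulChar K u) =
      (chiT K (u : Lat) ⊗ₜ[K] chiT K (u : Lat)) *
        ((1 : TorusAlg K) ⊗ₜ[K] chiT K D.e₁ + chiT K D.e₂ ⊗ₜ[K] (1 : TorusAlg K)) ^ D.expo u := by
  rw [add_comm ((1 : TorusAlg K) ⊗ₜ[K] chiT K D.e₁), add_pow, Finset.sum_range, Finset.mul_sum,
    DemazurePair.comulChar, map_sum]
  refine Finset.sum_congr rfl fun k _ => ?_
  rw [map_nsmul, Algebra.TensorProduct.map_tmul, incl_chi, incl_chi, DemazurePair.left,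
    DemazurePair.right, chiT_add, chiT_add, chiT_nsmul, chiT_nsmul,
    Algebra.TensorProduct.tmul_pow, Algebra.TensorProduct.tmul_pow, one_pow, one_pow,
    nsmul_eq_mul, Algebra.TensorProduct.tmul_mul_tmul, one_mul, mul_one, ← mul_assoc,
    Algebra.TensorProduct.tmul_mul_tmul, mul_comm]

theorem inclTwo_injective : Function.Injective
    (Algebra.TensorProduct.map (incl K σ) (incl K σ)) :=
  TensorProduct.map_injective_of_flat_flat (incl K σ).toLinearMap (incl K σ).toLinearMap
    incl_injective incl_injective

theorem inclThree_injective : Function.Injective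
    (Algebra.TensorProduct.map (incl K σ) (Algebra.TensorProduct.map (incl K σ) (incl K σ))) :=
  TensorProduct.map_injective_of_flat_flat (incl K σ).toLinearMap
    (Algebra.TensorProduct.map (incl K σ) (incl K σ)).toLinearMap
    incl_injective inclTwo_injective

theorem comulChar_zero : D.comulChar K 0 = 1 := by
  apply inclTwo_injective
  rw [incl_comulChar, map_one, D.expo_zero, pow_zero, mul_one]
  rfl

theorem comulChar_add (u v : charMonoid σ) :
    D.comulChar K (u + v) = D.comulChar K u * D.comulChar K v := by
  apply inclTwo_injective
  rw [map_mul, incl_comulChar, incl_comulChar, incl_comulChar, D.expo_add, pow_add,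
    AddSubmonoid.coe_add, chiT_add, ← Algebra.TensorProduct.tmul_mul_tmul]
  ring

theorem expo_left (u : charMonoid σ) (k : Fin (D.expo u + 1)) :
    D.expo (D.left u k) = D.expo u - k := by
  have hk := Nat.lt_succ_iff.1 k.2
  zify [hk]
  rw [D.expo_cast, D.expo_cast, DemazurePair.left, add_dotProduct, smul_dotProduct,
    D.root₂.pairing_eq]
  simp
  ring

theorem expo_right (u : charMonoid σ) (k : Fin (D.expo u + 1)) :
    D.expo (D.right u k) = k := by
  have hk := Nat.lt_succ_iff.1 k.2
  have h := D.expo_cast u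
  zify
  rw [D.expo_cast, DemazurePair.right, add_dotProduct, smul_dotProduct,
    D.root₁.pairing_eq, ← h, nsmul_eq_mul, Nat.cast_sub hk]
  ring

end Aux

namespace DemazurePair

/-- The comultiplication `χ^u ↦ χ^u ⊗ χ^u (1 ⊗ χ^{e₁} + χ^{e₂} ⊗ 1)^{⟨u, p⟩}` on `K[Z_σ]`. -/
noncomputable def comulHom (K : Type*) [Field K] {σ : SurfaceCone} (D : DemazurePair σ) :
    CoordAlg K σ →ₐ[K] CoordAlg K σ ⊗[K] CoordAlg K σ :=
  AddMonoidAlgebra.lift K _ (charMonoid σ)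
    { toFun := fun u => D.comulChar K u.toAdd
      map_one' := comulChar_zero D
      map_mul' := fun u v => comulChar_add D u.toAdd v.toAdd }

/-- The counit: `χ^u ↦ 1` if `⟨u, p⟩ = 0`, and `χ^u ↦ 0` otherwise. -/
noncomputable def counitHom (K : Type*) [Field K] {σ : SurfaceCone} (D : DemazurePair σ) :
    CoordAlg K σ →ₐ[K] K :=
  AddMonoidAlgebra.lift K _ (charMonoid σ)
    { toFun := fun u => 0 ^ D.expo u.toAdd
      map_one' := by
        change (0 : K) ^ D.expo 0 = 1
        rw [expo_zero, pow_zero]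
      map_mul' := fun u v => by
        change (0 : K) ^ D.expo (u.toAdd + v.toAdd) = _
        rw [expo_add, pow_add] }

end DemazurePair

section Binomial

variable {K T : Type*} [Field K] [CommRing T] [Algebra K T]

theorem binomial_left (w f g : T) (P : T ⊗[K] T) (m : ℕ) :
    ((w ⊗ₜ[K] w) ⊗ₜ[K] w) * ((g ⊗ₜ[K] g) ⊗ₜ[K] (1 : T) + P ⊗ₜ[K] f) ^ m =
      ∑ k : Fin (m + 1), m.choose k • ((((w * g ^ (k : ℕ)) ⊗ₜ[K] (w * g ^ (k : ℕ))) *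
        P ^ (m - k)) ⊗ₜ[K] (w * f ^ (m - (k : ℕ)))) := by
  rw [add_pow, Finset.sum_range, Finset.mul_sum]
  refine Finset.sum_congr rfl fun k _ => ?_
  simp only [Algebra.TensorProduct.tmul_pow, Algebra.TensorProduct.tmul_mul_tmul, one_pow,
    nsmul_eq_mul, one_mul]
  rw [← mul_assoc, Algebra.TensorProduct.tmul_mul_tmul, ← mul_assoc,
    Algebra.TensorProduct.tmul_mul_tmul, mul_comm]

theorem binomial_right (w f g : T) (P : T ⊗[K] T) (m : ℕ) :
    (w ⊗ₜ[K] (w ⊗ₜ[K] w)) * (g ⊗ₜ[K] P + (1 : T) ⊗ₜ[K] (f ⊗ₜ[K] f)) ^ m =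
      ∑ k : Fin (m + 1), m.choose k • ((w * g ^ (k : ℕ)) ⊗ₜ[K]
        (((w * f ^ (m - (k : ℕ))) ⊗ₜ[K] (w * f ^ (m - (k : ℕ)))) * P ^ (k : ℕ))) := by
  rw [add_pow, Finset.sum_range, Finset.mul_sum]
  refine Finset.sum_congr rfl fun k _ => ?_
  simp only [Algebra.TensorProduct.tmul_pow, Algebra.TensorProduct.tmul_mul_tmul, one_pow,
    nsmul_eq_mul, mul_one]
  rw [← mul_assoc, Algebra.TensorProduct.tmul_mul_tmul, mul_comm, mul_comm (P ^ (k : ℕ)),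
    ← mul_assoc, Algebra.TensorProduct.tmul_mul_tmul]

theorem binomial_assoc (w f g : T) (m : ℕ) :
    Algebra.TensorProduct.assoc K K K T T T (((w ⊗ₜ[K] w) ⊗ₜ[K] w) *
      ((g ⊗ₜ[K] g) ⊗ₜ[K] (1 : T) +
        ((1 : T) ⊗ₜ[K] f + g ⊗ₜ[K] (1 : T)) ⊗ₜ[K] f) ^ m) =
    (w ⊗ₜ[K] (w ⊗ₜ[K] w)) * (g ⊗ₜ[K] ((1 : T) ⊗ₜ[K] f + g ⊗ₜ[K] (1 : T)) +
      (1 : T) ⊗ₜ[K] (f ⊗ₜ[K] f)) ^ m := by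
  rw [map_mul, map_pow, map_add, TensorProduct.add_tmul, TensorProduct.tmul_add, map_add]
  simp only [Algebra.TensorProduct.assoc_tmul]
  congr 2
  abel

end Binomial

section Aux

variable {K : Type*} [Field K] {σ : SurfaceCone} (D : DemazurePair σ)

theorem comulHom_chi (u : charMonoid σ) : D.comulHom K (chi K u) = D.comulChar K u := by
  simp [DemazurePair.comulHom, chi]

theorem counitHom_chi (u : charMonoid σ) : D.counitHom K (chi K u) = 0 ^ D.expo u := by
  simp [DemazurePair.counitHom, chi]

theorem algHom_ext_chi {B : Type*} [Semiring B] [Algebra K B] {f g : CoordAlg K σ →ₐ[K] B}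
    (h : ∀ u, f (chi K u) = g (chi K u)) : f = g := by
  apply AddMonoidAlgebra.algHom_ext
  · exact h
  · exact Subsingleton.elim _ _

theorem coassoc_aux :
    (Algebra.TensorProduct.assoc K K K _ _ _).toAlgHom.comp
      ((Algebra.TensorProduct.map (D.comulHom K) (.id K _)).comp (D.comulHom K))
      = (Algebra.TensorProduct.map (.id K _) (D.comulHom K)).comp (D.comulHom K) := by
  apply algHom_ext_chi
  intro u
  change Algebra.TensorProduct.assoc K K K _ _ _
    (Algebra.TensorProduct.map (D.comulHom K) (.id K _) (D.comulHom K (chi K u))) =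
    Algebra.TensorProduct.map (.id K _) (D.comulHom K) (D.comulHom K (chi K u))
  apply inclThree_injective
  have hassoc : ∀ (x : CoordAlg K σ ⊗[K] CoordAlg K σ) (y : CoordAlg K σ),
      Algebra.TensorProduct.map (incl K σ) (Algebra.TensorProduct.map (incl K σ) (incl K σ))
        (Algebra.TensorProduct.assoc K K K _ _ _ (x ⊗ₜ[K] y)) =
      Algebra.TensorProduct.assoc K K K _ _ _
        ((Algebra.TensorProduct.map (incl K σ) (incl K σ) x) ⊗ₜ[K] incl K σ y) := by
    intro x y
    induction x with
    | zero => simp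
    | tmul a b => simp
    | add a b ha hb => simp only [TensorProduct.add_tmul, map_add, ha, hb]
  have hL : Algebra.TensorProduct.map (incl K σ) (Algebra.TensorProduct.map (incl K σ) (incl K σ))
      (Algebra.TensorProduct.assoc K K K _ _ _
      (Algebra.TensorProduct.map (D.comulHom K) (.id K _) (D.comulChar K u))) = _ :=
    (?_ : _ = _).trans (congrArg (Algebra.TensorProduct.assoc K K K _ _ _)
      (binomial_left (chiT K (u : Lat)) (chiT K D.e₁) (chiT K D.e₂)
        ((1 : TorusAlg K) ⊗ₜ[K] chiT K D.e₁ + chiT K D.e₂ ⊗ₜ[K] (1 : TorusAlg K))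
        (D.expo u)).symm)
  have hR : Algebra.TensorProduct.map (incl K σ) (Algebra.TensorProduct.map (incl K σ) (incl K σ))
      (Algebra.TensorProduct.map (.id K _) (D.comulHom K) (D.comulChar K u)) = _ :=
    (?_ : _ = _).trans
      (binomial_right (chiT K (u : Lat)) (chiT K D.e₁) (chiT K D.e₂)
        ((1 : TorusAlg K) ⊗ₜ[K] chiT K D.e₁ + chiT K D.e₂ ⊗ₜ[K] (1 : TorusAlg K))
        (D.expo u)).symm
  · rw [comulHom_chi, hL, hR, binomial_assoc]
  · rw [DemazurePair.comulChar]
    simp only [map_sum]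
    refine Finset.sum_congr rfl fun k _ => ?_
    simp only [map_nsmul, Algebra.TensorProduct.map_tmul, comulHom_chi, AlgHom.id_apply]
    rw [incl_comulChar, incl_chi, expo_right, DemazurePair.left, DemazurePair.right, chiT_add,
      chiT_add, chiT_nsmul, chiT_nsmul]
  · rw [DemazurePair.comulChar]
    simp only [map_sum]
    refine Finset.sum_congr rfl fun k _ => ?_
    simp only [map_nsmul, Algebra.TensorProduct.map_tmul, comulHom_chi, AlgHom.id_apply]
    rw [hassoc, incl_comulChar, incl_chi, expo_left, DemazurePair.left, DemazurePair.right,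
      chiT_add, chiT_add, chiT_nsmul, chiT_nsmul]

theorem rTensor_aux : (Algebra.TensorProduct.map (D.counitHom K) (.id K _)).comp (D.comulHom K)
      = (Algebra.TensorProduct.lid K (CoordAlg K σ)).symm := by
  apply algHom_ext_chi
  intro u
  change Algebra.TensorProduct.map (D.counitHom K) (.id K _) (D.comulHom K (chi K u)) =
    (1 : K) ⊗ₜ[K] chi K u
  rw [comulHom_chi, DemazurePair.comulChar, map_sum, Fin.sum_univ_castSucc,
    Finset.sum_eq_zero, zero_add]
  · rw [map_nsmul, Algebra.TensorProduct.map_tmul, counitHom_chi, expo_left]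
    simp [DemazurePair.right]
  · intro k _
    rw [map_nsmul, Algebra.TensorProduct.map_tmul, counitHom_chi, expo_left]
    have : D.expo u - (k.castSucc : ℕ) ≠ 0 := by
      have := k.2
      simp only [Fin.val_castSucc]
      omega
    rw [zero_pow this, TensorProduct.zero_tmul, smul_zero]

theorem lTensor_aux : (Algebra.TensorProduct.map (.id K _) (D.counitHom K)).comp (D.comulHom K)
      = (Algebra.TensorProduct.rid K K (CoordAlg K σ)).symm := by
  apply algHom_ext_chi
  intro u
  change Algebra.TensorProduct.map (.id K _) (D.counitHom K) (D.comulHom K (chi K u)) =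
    chi K u ⊗ₜ[K] (1 : K)
  rw [comulHom_chi, DemazurePair.comulChar, map_sum, Fin.sum_univ_succ,
    Finset.sum_eq_zero, add_zero]
  · rw [map_nsmul, Algebra.TensorProduct.map_tmul, counitHom_chi, expo_right]
    simp [DemazurePair.left]
  · intro k _
    rw [map_nsmul, Algebra.TensorProduct.map_tmul, counitHom_chi, expo_right]
    simp

end Aux

/-- The coordinate algebra of the affine algebraic monoid with underlying variety `Z_σ` and the
multiplication determined by the pair `(e₁, e₂)`: the algebra `K[Z_σ]`, with the bialgebra
structure below. -/
def DemazureBialg (K : Type*) [Field K] {σ : SurfaceCone} (_D : DemazurePair σ) : Type _ :=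
  CoordAlg K σ

noncomputable instance (K : Type*) [Field K] {σ : SurfaceCone} (D : DemazurePair σ) :
    CommRing (DemazureBialg K D) :=
  inferInstanceAs (CommRing (CoordAlg K σ))

noncomputable instance (K : Type*) [Field K] {σ : SurfaceCone} (D : DemazurePair σ) :
    Bialgebra K (DemazureBialg K D) :=
  Bialgebra.ofAlgHom (A := CoordAlg K σ) (D.comulHom K) (D.counitHom K)
    (coassoc_aux D) (rTensor_aux D) (lTensor_aux D)

theorem comul_def (K : Type*) [Field K] {σ : SurfaceCone} (D : DemazurePair σ)
    (u : charMonoid σ) :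
    Coalgebra.comul (R := K) (A := DemazureBialg K D) (chi K u) = D.comulChar K u :=
  comulHom_chi D u

theorem counit_def (K : Type*) [Field K] {σ : SurfaceCone} (D : DemazurePair σ)
    (u : charMonoid σ) :
    Coalgebra.counit (R := K) (A := DemazureBialg K D) (chi K u) = 0 ^ D.expo u :=
  counitHom_chi D u

/-- The monoid structures on `Z_σ` determined by `D` and `D'` are isomorphic as affine algebraic
monoids (equivalently, their coordinate bialgebras are isomorphic). -/
def IsoMonoids (K : Type*) [Field K] {σ : SurfaceCone} (D D' : DemazurePair σ) : Prop :=
  Nonempty (DemazureBialg K D ≃ₐc[K] DemazureBialg K D')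

end ToricSurface

namespace ToricSurface

/-! ### Lattice and cone geometry -/

/-! The pair of roots is recovered from the bialgebra by invariants that any isomorphism `φ` must
respect. The group-like elements are exactly the characters `χ^a` with `⟨a, p⟩ = 0`. If `⟨u, p⟩ =
1`, then `Δ χ^u = χ^u ⊗ χ^{u+e₁} + χ^{u+e₂} ⊗ χ^u`, so `χ^u` is skew-primitive between two
group-likes and the roots are the differences of the exponents. The image `φ(χ^u)` may contain
several characters orthogonal to `p'`, but only one other character `χ^{u'}`, and that one satisfies
`⟨u', p'⟩ = 1` and `u' + eᵢ' = (image of u + eᵢ)` (`exists_eq_chi_of_comul`, `of_skewPrimitive`).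

Choose `U` with `⟨U, p⟩ = 1` and a generator `W` of `p^⊥`; they form a basis of `M`. Sending `U` to
the exponent of the leading term of `φ(χ^U)` and `W` to the exponent of the group-like `φ(χ^W)`
defines an integral matrix `A` with `A eᵢ = eᵢ'`. Leading terms multiply, so `χ^{A v}` occurs in
`φ(χ^v)` for every `v ∈ σ^∨ ∩ M`, and hence `A` preserves `σ^∨ ∩ M` (`exists_matrix`). The same
construction for `φ⁻¹` gives the inverse of `A`. Thus `A` is a lattice automorphism permuting the
two edges of `σ^∨`: it is the identity or the swap, and the swap is possible only if it preserves
`M`.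

Conversely, a lattice automorphism preserving `σ^∨ ∩ M` relabels characters and transports the
comultiplication formula, so it yields an isomorphism between a pair of roots and its image. -/

theorem toQ_injective : Function.Injective toQ := fun u v h => by
  ext i
  have := congrFun h i
  simpa [toQ_apply] using this

/-- A Bézout relation for `q` makes the ratio of the two vectors an integer; one for `p` makes this
integer divide 1. -/
theorem eq_of_mem_ray {p q : Lat} (hp : IsCoprime (p 0) (p 1)) (hq : IsCoprime (q 0) (q 1))
    (h : toQ p ∈ PointedCone.hull ℚ {toQ q}) : p = q := by
  obtain ⟨c, hc, hcp⟩ := mem_ray.1 h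
  have hi : ∀ i, c * (q i : ℚ) = p i := fun i => congrFun hcp i
  obtain ⟨a, b, hab⟩ := hp
  obtain ⟨a', b', hab'⟩ := hq
  have h1 : c = ((a' * p 0 + b' * p 1 : ℤ) : ℚ) := by
    have : (a' * q 0 + b' * q 1 : ℚ) = 1 := by exact_mod_cast hab'
    push_cast
    rw [← hi 0, ← hi 1]
    linear_combination -c * this
  generalize a' * p 0 + b' * p 1 = n at h1
  subst h1
  have hi' : ∀ i, n * q i = p i := fun i => by exact_mod_cast hi i
  have hn : n ∣ 1 := ⟨a * q 0 + b * q 1, by rw [← hab, ← hi' 0, ← hi' 1]; ring⟩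
  have hn0 : 0 ≤ n := by exact_mod_cast hc
  have hn1 : n = 1 := Int.eq_one_of_dvd_one hn0 hn
  ext i
  rw [← hi' i, hn1, one_mul]

theorem IsRayGenerator.mem {C : PointedCone ℚ LatQ} {p : Lat} (hp : IsRayGenerator C p) :
    toQ p ∈ C :=
  hp.isFaceOf.le (mem_ray.2 ⟨1, zero_le_one, one_smul _ _⟩)

theorem toQ_ne_zero {p : Lat} (hp : IsCoprime (p 0) (p 1)) : toQ p ≠ 0 := by
  intro h
  have h0 : p = 0 := toQ_injective (by rw [h, map_zero])
  rw [h0] at hp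
  exact not_isCoprime_zero_zero hp

/-- The determinant of two vectors of `ℚ²`. -/
def cross (x y : LatQ) : ℚ := x 0 * y 1 - x 1 * y 0

/-- Cramer's rule, without division. -/
theorem cross_smul_eq (x y z : LatQ) : cross x y • z = cross z y • x + cross x z • y := by
  ext i
  fin_cases i <;> simp [cross] <;> ring

/-! ### Coordinates along the two edges of a strongly convex plane cone. -/

section Salient

variable {C : PointedCone ℚ LatQ} (hC : (C : ConvexCone ℚ LatQ).Salient) {p q : Lat}
  (hp : IsRayGenerator C p) (hq : IsRayGenerator C q) (hpq : p ≠ q)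

include hC hp hq hpq

/-- Parallel primitive vectors are equal or opposite, and opposite ones would put a line in the
cone. -/
theorem cross_ne_zero : cross (toQ p) (toQ q) ≠ 0 := by
  intro h
  obtain ⟨a, b, hab⟩ := hq.primitive
  have hab' : (a * q 0 + b * q 1 : ℚ) = 1 := by exact_mod_cast hab
  have hcr : (p 0 * q 1 - p 1 * q 0 : ℚ) = 0 := h
  have hc : toQ p = (a * p 0 + b * p 1 : ℚ) • toQ q := by
    ext i
    fin_cases i
    · change (p 0 : ℚ) = (a * p 0 + b * p 1) * q 0
      linear_combination (-(p 0 : ℚ)) * hab' + b * hcr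
    · change (p 1 : ℚ) = (a * p 0 + b * p 1) * q 1
      linear_combination (-(p 1 : ℚ)) * hab' - a * hcr
  generalize (a * p 0 + b * p 1 : ℚ) = c at hc
  rcases le_or_gt 0 c with h0 | h0
  · exact hpq (eq_of_mem_ray hp.primitive hq.primitive (mem_ray.2 ⟨c, h0, hc.symm⟩))
  · refine hC _ hp.mem (toQ_ne_zero hp.primitive) ?_
    change -toQ p ∈ C
    rw [hc, ← neg_smul]
    exact PointedCone.smul_mem _ (by linarith) hq.mem

/-- Suppose `a < 0`. If `b < 0` as well, cancelling the `q` term puts `-p` in the cone. If `b ≥ 0`,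
adding `-a p` lands on the edge of `q`, and the face property puts `p` on that edge. -/
theorem coord_nonneg {a b : ℚ} (h : a • toQ p + b • toQ q ∈ C) : 0 ≤ a := by
  by_contra! ha
  have hb : 0 ≤ b := by
    by_contra! hb
    refine hC _ hp.mem (toQ_ne_zero hp.primitive) ?_
    change -toQ p ∈ C
    have e : -toQ p = (-a⁻¹) • ((a • toQ p + b • toQ q) + (-b) • toQ q) := by
      rw [add_assoc, ← add_smul, add_neg_cancel, zero_smul, add_zero, smul_smul, neg_mul,
        inv_mul_cancel₀ ha.ne, neg_one_smul]
    rw [e]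
    refine PointedCone.smul_mem _ ?_
      (Submodule.add_mem _ h (PointedCone.smul_mem _ (by linarith) hq.mem))
    have := inv_lt_zero.2 ha
    linarith
  refine hpq (eq_of_mem_ray hp.primitive hq.primitive ?_)
  refine hq.isFaceOf.mem_of_smul_add_mem hp.mem h (a := -a) (by linarith) ?_
  rw [← add_assoc, ← add_smul, neg_add_cancel, zero_smul, zero_add]
  exact mem_ray.2 ⟨b, hb, rfl⟩

theorem exists_coords {x : LatQ} (hx : x ∈ C) :
    ∃ a b : ℚ, 0 ≤ a ∧ 0 ≤ b ∧ x = a • toQ p + b • toQ q := by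
  have hd := cross_ne_zero hC hp hq hpq
  have e : x = (cross x (toQ q) / cross (toQ p) (toQ q)) • toQ p +
      (cross (toQ p) x / cross (toQ p) (toQ q)) • toQ q := by
    rw [div_eq_inv_mul, div_eq_inv_mul, mul_smul, mul_smul, ← smul_add, ← cross_smul_eq,
      inv_smul_smul₀ hd]
  refine ⟨_, _, ?_, ?_, e⟩
  · rw [e] at hx
    exact coord_nonneg hC hp hq hpq hx
  · rw [e, add_comm] at hx
    exact coord_nonneg hC hq hp hpq.symm hx

/-- Write `r = a p + b q`. If `a = 0`, then `r` lies on the ray of `q`; if `a > 0`, the face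
property of the edge of `r` forces `p` onto it. -/
theorem eq_or_eq_of_isRayGenerator {r : Lat} (hr : IsRayGenerator C r) : r = p ∨ r = q := by
  obtain ⟨a, b, ha, hb, e⟩ := exists_coords hC hp hq hpq hr.mem
  have hray : a • toQ p + b • toQ q ∈ PointedCone.hull ℚ {toQ r} :=
    mem_ray.2 ⟨1, zero_le_one, by rw [one_smul, e]⟩
  rcases ha.eq_or_lt with h0 | h0
  · right
    rw [← h0, zero_smul, zero_add] at e
    exact eq_of_mem_ray hr.primitive hq.primitive (mem_ray.2 ⟨b, hb, e.symm⟩)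
  · left
    exact (eq_of_mem_ray hp.primitive hr.primitive (hr.isFaceOf.mem_of_smul_add_mem hp.mem
      (PointedCone.smul_mem _ hb hq.mem) h0 hray)).symm

end Salient

/-! ### The edges of `σ` and of its dual. -/

/-- Otherwise the cone would lie on a line. Since `p` is arbitrary, `p = 0` produces a first ray
generator and a second use produces another. -/
theorem exists_ne_rayGenerator (σ : SurfaceCone) (p : Lat) :
    ∃ q, IsRayGenerator σ.cone q ∧ q ≠ p := by
  by_contra! h
  have h1 : (σ.cone : Set LatQ) ⊆ Submodule.span ℚ {toQ p} := by
    have hle : σ.cone ≤ PointedCone.hull ℚ {toQ p} := by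
      rw [cone_eq_hull_rays σ]
      refine Submodule.span_mono ?_
      rintro _ ⟨q, hq, rfl⟩
      rw [h q hq, Set.mem_singleton_iff]
    intro x hx
    obtain ⟨c, -, rfl⟩ := mem_ray.1 (hle hx)
    exact Submodule.smul_mem _ _ (Submodule.mem_span_singleton_self _)
  have h2 : Submodule.span ℚ {toQ p} = ⊤ := top_le_iff.1 (by
    rw [← σ.span_eq_top]
    exact Submodule.span_le.2 h1)
  have h3 := finrank_span_le_card (R := ℚ) ({toQ p} : Set LatQ)
  rw [h2] at h3
  simp at h3

/-- If `x` and `-x` are both in the dual cone, then `x` is orthogonal to `σ`, which spans the plane.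
-/
theorem salient_dualCone (σ : SurfaceCone) :
    ((dualCone σ.cone : PointedCone ℚ LatQ) : ConvexCone ℚ LatQ).Salient := by
  intro x hx hx0 hnx
  apply hx0
  have h : ∀ y ∈ Submodule.span ℚ (σ.cone : Set LatQ), y ⬝ᵥ x = 0 := by
    intro y hy
    induction hy using Submodule.span_induction with
    | mem y hy =>
      have h1 : 0 ≤ y ⬝ᵥ x := hx hy
      have h2 : 0 ≤ y ⬝ᵥ (-x) := hnx hy
      rw [dotProduct_neg] at h2
      linarith
    | zero => simp
    | add a b _ _ ha hb => rw [add_dotProduct, ha, hb, add_zero]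
    | smul c a _ ha => rw [smul_dotProduct, ha, smul_zero]
  rw [σ.span_eq_top] at h
  exact dotProduct_self_eq_zero.1 (h x trivial)

theorem mem_charMonoid_iff_two {σ : SurfaceCone} {p q : Lat} (hp : IsRayGenerator σ.cone p)
    (hq : IsRayGenerator σ.cone q) (hpq : p ≠ q) {u : Lat} :
    u ∈ charMonoid σ ↔ 0 ≤ u ⬝ᵥ p ∧ 0 ≤ u ⬝ᵥ q := by
  rw [mem_charMonoid_iff]
  refine ⟨fun h => ⟨h _ hp, h _ hq⟩, fun h r hr => ?_⟩
  rcases eq_or_eq_of_isRayGenerator σ.salient hp hq hpq hr with rfl | rfl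
  · exact h.1
  · exact h.2

/-- A nonzero element of `σ^∨ ∩ M` on the edge of `σ^∨` orthogonal to the ray generator `p`, which
generates the lattice of all vectors orthogonal to `p`. -/
theorem exists_edge {σ : SurfaceCone} {p q : Lat} (hp : IsRayGenerator σ.cone p)
    (hq : IsRayGenerator σ.cone q) (hpq : p ≠ q) :
    ∃ w : Lat, w ⬝ᵥ p = 0 ∧ 0 < w ⬝ᵥ q ∧ ∀ v : Lat, v ⬝ᵥ p = 0 → ∃ t : ℤ, v = t • w := by
  have hd : p 0 * q 1 - p 1 * q 0 ≠ 0 := by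
    have := cross_ne_zero σ.salient hp hq hpq
    simp only [cross, toQ_apply] at this
    exact_mod_cast this
  obtain ⟨a, b, hab⟩ := hp.primitive
  -- The Bézout coefficients of `p` compute the integral multiple.
  have key : ∀ v : Lat, v ⬝ᵥ p = 0 → v = (a * v 1 - b * v 0) • ![-p 1, p 0] := by
    intro v hv
    have hv' : v 0 * p 0 + v 1 * p 1 = 0 := by simpa [dotProduct] using hv
    ext i
    fin_cases i
    · simp
      linear_combination -v 0 * hab + a * hv'
    · simp
      linear_combination -v 1 * hab + b * hv'
  -- The sign of the generator of `p^⊥` is chosen so that its pairing with `q`, up to sign the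
  -- determinant of `p` and `q`, is positive.
  rcases hd.lt_or_gt with h | h
  · refine ⟨![p 1, -p 0], by simp [dotProduct]; ring, by simp [dotProduct]; linarith,
      fun v hv => ⟨-(a * v 1 - b * v 0), ?_⟩⟩
    conv_lhs => rw [key v hv]
    ext i
    fin_cases i <;> simp <;> ring
  · exact ⟨![-p 1, p 0], by simp [dotProduct]; ring, by simp [dotProduct]; linarith,
      fun v hv => ⟨_, key v hv⟩⟩

/-- Biduality. Testing against the lattice vector on the edge of `σ^∨` orthogonal to one ray
generator isolates the coefficient of the other. -/
theorem mem_cone_of_forall_charMonoid {σ : SurfaceCone} {v : LatQ}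
    (h : ∀ u ∈ charMonoid σ, 0 ≤ toQ u ⬝ᵥ v) : v ∈ σ.cone := by
  obtain ⟨p, hp, -⟩ := exists_ne_rayGenerator σ 0
  obtain ⟨q, hq, hqp⟩ := exists_ne_rayGenerator σ p
  have hd := cross_ne_zero σ.salient hp hq hqp.symm
  set d := cross (toQ p) (toQ q) with hd'
  have aux : ∀ p q : Lat, IsRayGenerator σ.cone p → IsRayGenerator σ.cone q → p ≠ q →
      ∀ a b : ℚ, v = a • toQ p + b • toQ q → 0 ≤ b := by
    intro p q hp hq hpq a b hv
    obtain ⟨w, hwp, hwq, -⟩ := exists_edge hp hq hpq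
    have := h w ((mem_charMonoid_iff_two hp hq hpq).2 ⟨hwp.ge, hwq.le⟩)
    rw [hv, dotProduct_add, dotProduct_smul, dotProduct_smul, toQ_dotProduct, toQ_dotProduct, hwp]
      at this
    rw [Int.cast_zero, smul_zero, zero_add, smul_eq_mul] at this
    have hwq' : (0 : ℚ) < ((w ⬝ᵥ q : ℤ) : ℚ) := by exact_mod_cast hwq
    exact nonneg_of_mul_nonneg_left this hwq'
  have e : v = (cross v (toQ q) / d) • toQ p + (cross (toQ p) v / d) • toQ q := by
    rw [div_eq_inv_mul, div_eq_inv_mul, mul_smul, mul_smul, ← smul_add, ← cross_smul_eq,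
      inv_smul_smul₀ hd]
  rw [e]
  exact Submodule.add_mem _
    (PointedCone.smul_mem _ (aux q p hq hp hqp _ _ (e.trans (add_comm _ _))) hp.mem)
    (PointedCone.smul_mem _ (aux p q hp hq hqp.symm _ _ e) hq.mem)

/-! ### Lattice automorphisms -/

/-- The linear map of `ℚ²` given by an integral matrix. -/
def matQ (A : Matrix (Fin 2) (Fin 2) ℤ) : LatQ →ₗ[ℚ] LatQ :=
  Matrix.mulVecLin (A.map (Int.cast : ℤ → ℚ))

theorem matQ_toQ (A : Matrix (Fin 2) (Fin 2) ℤ) (u : Lat) : matQ A (toQ u) = toQ (A.mulVec u) := by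
  ext i
  fin_cases i <;> simp [matQ, toQ_apply]

theorem matQ_matQ {A B : Matrix (Fin 2) (Fin 2) ℤ} (h : A * B = 1) (x : LatQ) :
    matQ A (matQ B x) = x := by
  have hm : (A.map (Int.cast : ℤ → ℚ)) * (B.map (Int.cast : ℤ → ℚ)) = 1 := by
    have := congrArg (fun X : Matrix (Fin 2) (Fin 2) ℤ => X.map (Int.castRingHom ℚ)) h
    rw [Matrix.map_mul, Matrix.map_one _ (map_zero _) (map_one _)] at this
    exact this
  rw [matQ, matQ, Matrix.mulVecLin_apply, Matrix.mulVecLin_apply, Matrix.mulVec_mulVec, hm,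
    Matrix.one_mulVec]

theorem dotProduct_matQ (A : Matrix (Fin 2) (Fin 2) ℤ) (x y : LatQ) :
    x ⬝ᵥ matQ A y = matQ A.transpose x ⬝ᵥ y := by
  rw [matQ, matQ, Matrix.mulVecLin_apply, Matrix.mulVecLin_apply, Matrix.transpose_map,
    Matrix.dotProduct_mulVec, Matrix.mulVec_transpose]

theorem IsRayGenerator.mulVec {C : PointedCone ℚ LatQ} {A B : Matrix (Fin 2) (Fin 2) ℤ}
    (hAB : A * B = 1) (hBA : B * A = 1) (hA : ∀ x ∈ C, matQ A x ∈ C) (hB : ∀ x ∈ C, matQ B x ∈ C)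
    {p : Lat} (hp : IsRayGenerator C p) : IsRayGenerator C (A.mulVec p) where
  primitive := by
    obtain ⟨a, b, hab⟩ := hp.primitive
    have h : ![a, b] ⬝ᵥ B.mulVec (A.mulVec p) = 1 := by
      rw [Matrix.mulVec_mulVec, hBA, Matrix.one_mulVec]
      simpa [dotProduct] using hab
    rw [Matrix.dotProduct_mulVec] at h
    exact ⟨_, _, by simpa [dotProduct] using h⟩
  isFaceOf := by
    have key : ∀ x, x ∈ PointedCone.hull ℚ {toQ (A.mulVec p)} ↔
        matQ B x ∈ PointedCone.hull ℚ {toQ p} := by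
      intro x
      rw [mem_ray, mem_ray]
      refine exists_congr fun c => and_congr_right fun _ => ⟨?_, ?_⟩
      · rintro rfl
        rw [map_smul, ← matQ_toQ, matQ_matQ hBA]
      · intro h
        rw [← matQ_toQ, ← map_smul, h, matQ_matQ hAB]
    refine ⟨fun x hx => ?_, fun {x y a} hx hy ha hxy => ?_⟩
    · rw [← matQ_matQ hAB x]
      exact hA _ (hp.isFaceOf.le ((key x).1 hx))
    · rw [key] at hxy ⊢
      rw [map_add, map_smul] at hxy
      exact hp.isFaceOf.mem_of_smul_add_mem (hB x hx) (hB y hy) ha hxy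

/-- The pair of mutually inverse integral matrices `A`, `B` acts on `M` by automorphisms that
preserve `σ^∨ ∩ M`. -/
structure IsSymmetry (σ : SurfaceCone) (A B : Matrix (Fin 2) (Fin 2) ℤ) : Prop where
  mul_eq : A * B = 1
  mul_eq' : B * A = 1
  map_mem : ∀ u ∈ charMonoid σ, A.mulVec u ∈ charMonoid σ
  map_mem' : ∀ u ∈ charMonoid σ, B.mulVec u ∈ charMonoid σ

/-! ### Action of a symmetry on rays, roots and pairs. -/

namespace IsSymmetry

variable {σ : SurfaceCone} {A B : Matrix (Fin 2) (Fin 2) ℤ} (h : IsSymmetry σ A B)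

include h

theorem symm : IsSymmetry σ B A := ⟨h.mul_eq', h.mul_eq, h.map_mem', h.map_mem⟩

/-- By biduality, membership in `σ` is tested on `σ^∨ ∩ M`, where the transpose moves over to `A`.
-/
theorem transpose_mem {v : LatQ} (hv : v ∈ σ.cone) : matQ A.transpose v ∈ σ.cone := by
  apply mem_cone_of_forall_charMonoid
  intro u hu
  rw [dotProduct_matQ, Matrix.transpose_transpose, matQ_toQ, dotProduct_comm]
  exact mem_charMonoid.1 (h.map_mem u hu) v hv

theorem dualCone_mem {x : LatQ} (hx : x ∈ dualCone σ.cone) : matQ A x ∈ dualCone σ.cone := by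
  intro v hv
  change 0 ≤ v ⬝ᵥ matQ A x
  rw [dotProduct_matQ]
  exact hx (h.transpose_mem hv)

theorem dualCone_rayGenerator {v : Lat} (hv : IsRayGenerator (dualCone σ.cone) v) :
    IsRayGenerator (dualCone σ.cone) (A.mulVec v) :=
  hv.mulVec h.mul_eq h.mul_eq' (fun _ => h.dualCone_mem) (fun _ => h.symm.dualCone_mem)

theorem cone_rayGenerator {p : Lat} (hp : IsRayGenerator σ.cone p) :
    IsRayGenerator σ.cone (A.transpose.mulVec p) :=
  hp.mulVec (by rw [← Matrix.transpose_mul, h.mul_eq', Matrix.transpose_one])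
    (by rw [← Matrix.transpose_mul, h.mul_eq, Matrix.transpose_one])
    (fun _ => h.transpose_mem) (fun _ => h.symm.transpose_mem)

/-- When `A` acts on `M`, the action on `N` preserving the pairing is the inverse transpose. -/
theorem dotProduct_mulVec_transpose (u v : Lat) :
    A.mulVec u ⬝ᵥ B.transpose.mulVec v = u ⬝ᵥ v := by
  rw [Matrix.mulVec_transpose, dotProduct_comm, ← Matrix.dotProduct_mulVec, Matrix.mulVec_mulVec,
    h.mul_eq', Matrix.one_mulVec, dotProduct_comm]

theorem transpose_mulVec (v : Lat) : B.transpose.mulVec (A.transpose.mulVec v) = v := by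
  rw [Matrix.mulVec_mulVec, ← Matrix.transpose_mul, h.mul_eq, Matrix.transpose_one,
    Matrix.one_mulVec]

theorem isDemazureRoot {p e : Lat} (he : IsDemazureRoot σ p e) :
    IsDemazureRoot σ (B.transpose.mulVec p) (A.mulVec e) where
  isRayGenerator := h.symm.cone_rayGenerator he.isRayGenerator
  pairing_eq := by rw [h.dotProduct_mulVec_transpose, he.pairing_eq]
  pairing_nonneg q hq hqp := by
    have e := h.transpose_mulVec q
    rw [← e, h.dotProduct_mulVec_transpose]
    refine he.pairing_nonneg _ (h.cone_rayGenerator hq) ?_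
    rintro rfl
    exact hqp e.symm

/-- The action of a symmetry of `σ` on pairs of Demazure roots. -/
def mapPair (D : DemazurePair σ) : DemazurePair σ where
  p := B.transpose.mulVec D.p
  e₁ := A.mulVec D.e₁
  e₂ := A.mulVec D.e₂
  root₁ := h.isDemazureRoot D.root₁
  root₂ := h.isDemazureRoot D.root₂

end IsSymmetry

/-- The root takes the value -1 on `p'` but is nonnegative on every ray generator other than `p`.
Hence roots alone determine the ray. -/
theorem IsDemazureRoot.ray_eq {σ : SurfaceCone} {p p' e : Lat} (h : IsDemazureRoot σ p e)
    (h' : IsDemazureRoot σ p' e) : p = p' := by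
  by_contra hne
  have := h.pairing_nonneg p' h'.isRayGenerator (Ne.symm hne)
  rw [h'.pairing_eq] at this
  omega

/-! ### Symmetries of the cone induce isomorphisms -/

namespace IsSymmetry

variable {σ : SurfaceCone} {A B : Matrix (Fin 2) (Fin 2) ℤ} (h : IsSymmetry σ A B)

/-- The automorphism of the monoid `σ^∨ ∩ M` given by a symmetry of `σ`. -/
def charEquiv : charMonoid σ ≃+ charMonoid σ where
  toFun u := ⟨A.mulVec u, h.map_mem u u.2⟩
  invFun u := ⟨B.mulVec u, h.map_mem' u u.2⟩
  left_inv u := Subtype.ext (by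
    change B.mulVec (A.mulVec u) = u
    rw [Matrix.mulVec_mulVec, h.mul_eq', Matrix.one_mulVec])
  right_inv u := Subtype.ext (by
    change A.mulVec (B.mulVec u) = u
    rw [Matrix.mulVec_mulVec, h.mul_eq, Matrix.one_mulVec])
  map_add' u v := Subtype.ext (by
    change A.mulVec ((u : Lat) + v) = A.mulVec u + A.mulVec v
    exact Matrix.mulVec_add _ _ _)

variable (K : Type*) [Field K]

/-- The automorphism of `K[Z_σ]` given by a symmetry of `σ`. -/
noncomputable def coordEquiv : CoordAlg K σ ≃ₐ[K] CoordAlg K σ :=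
  AddMonoidAlgebra.domCongr K K h.charEquiv

theorem coordEquiv_chi (u : charMonoid σ) : h.coordEquiv K (chi K u) = chi K (h.charEquiv u) :=
  AddMonoidAlgebra.domCongr_single _ _ _

/-- The endomorphism of `K[M]` given by an integral matrix. -/
noncomputable def torusMap (A : Matrix (Fin 2) (Fin 2) ℤ) : TorusAlg K →ₐ[K] TorusAlg K :=
  AddMonoidAlgebra.mapDomainAlgHom K K (Matrix.mulVecLin A).toAddMonoidHom

omit h in
theorem torusMap_chiT (u : Lat) : torusMap K A (chiT K u) = chiT K (A.mulVec u) := by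
  simp [torusMap, chiT]

theorem incl_coordEquiv :
    (incl K σ).comp (h.coordEquiv K).toAlgHom = (torusMap K A).comp (incl K σ) := by
  apply algHom_ext_chi
  intro u
  change incl K σ (h.coordEquiv K (chi K u)) = torusMap K A (incl K σ (chi K u))
  rw [coordEquiv_chi, incl_chi, incl_chi, torusMap_chiT]
  rfl

variable {D D' : DemazurePair σ} (h₁ : A.mulVec D.e₁ = D'.e₁) (h₂ : A.mulVec D.e₂ = D'.e₂)

include h₁ in
theorem expo_charEquiv (u : charMonoid σ) : D'.expo (h.charEquiv u) = D.expo u := by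
  have hp : B.transpose.mulVec D.p = D'.p :=
    (h.isDemazureRoot D.root₁).ray_eq (h₁ ▸ D'.root₁)
  rw [DemazurePair.expo, DemazurePair.expo, ← hp]
  exact congrArg Int.toNat (h.dotProduct_mulVec_transpose _ _)

include h₁ h₂ in
-- Inside `K[M] ⊗ K[M]` the comultiplication is a product of powers, so ring homomorphisms pass
-- through it and the binomial sum never has to be reindexed.
theorem map_comulChar (u : charMonoid σ) :
    Algebra.TensorProduct.map (h.coordEquiv K).toAlgHom (h.coordEquiv K).toAlgHom
      (D.comulChar K u) = D'.comulChar K (h.charEquiv u) := by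
  apply inclTwo_injective
  rw [← AlgHom.comp_apply, ← Algebra.TensorProduct.map_comp, incl_coordEquiv,
    Algebra.TensorProduct.map_comp, AlgHom.comp_apply, incl_comulChar, incl_comulChar,
    h.expo_charEquiv h₁]
  simp only [map_mul, map_pow, map_add, Algebra.TensorProduct.map_tmul, torusMap_chiT, map_one,
    h₁, h₂]
  rfl

include h h₁ h₂ in
theorem isoMonoids : IsoMonoids K D D' := by
  refine ⟨BialgEquiv.ofAlgEquiv (A := DemazureBialg K D) (B := DemazureBialg K D')
    (h.coordEquiv K) ?_ ?_⟩
  · apply algHom_ext_chi (σ := σ)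
    intro u
    change D'.counitHom K (h.coordEquiv K (chi K u)) = D.counitHom K (chi K u)
    rw [coordEquiv_chi, counitHom_chi, counitHom_chi, h.expo_charEquiv h₁]
  · apply algHom_ext_chi (σ := σ)
    intro u
    change Algebra.TensorProduct.map (h.coordEquiv K).toAlgHom (h.coordEquiv K).toAlgHom
      (D.comulHom K (chi K u)) = D'.comulHom K (h.coordEquiv K (chi K u))
    rw [coordEquiv_chi, comulHom_chi, comulHom_chi, h.map_comulChar K h₁ h₂]

end IsSymmetry

theorem IsoMonoids.exists_algEquiv {K : Type*} [Field K] {σ : SurfaceCone} {D D' : DemazurePair σ}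
    (h : IsoMonoids K D D') : ∃ φ : CoordAlg K σ ≃ₐ[K] CoordAlg K σ, ∀ x,
      Algebra.TensorProduct.map φ.toAlgHom φ.toAlgHom (D.comulHom K x) = D'.comulHom K (φ x) := by
  obtain ⟨f⟩ := h
  exact ⟨(f : DemazureBialg K D ≃ₐ[K] DemazureBialg K D'),
    fun x => CoalgHomClass.map_comp_comul_apply (R := K) (A := DemazureBialg K D)
      (B := DemazureBialg K D') f x⟩

/-! ### Coefficients and the comultiplication -/

section Coefficients

variable {K : Type*} [Field K] {σ : SurfaceCone}

/-- The coefficient of `χ^a`, as a linear form on `K[Z_σ]`. -/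
noncomputable def coef (K : Type*) [Field K] (σ : SurfaceCone) (a : Lat) : CoordAlg K σ →ₗ[K] K :=
  Finsupp.lapply a ∘ₗ (AddMonoidAlgebra.coeffLinearEquiv K).toLinearMap ∘ₗ
    (incl K σ).toLinearMap

theorem coef_apply (a : Lat) (x : CoordAlg K σ) : coef K σ a x = (incl K σ x).coeff a := rfl

theorem coef_chi (a : Lat) (u : charMonoid σ) :
    coef K σ a (chi K u) = if (u : Lat) = a then 1 else 0 := by
  rw [coef_apply, incl_chi, chiT, AddMonoidAlgebra.coeff_single, Finsupp.single_apply]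

theorem coef_coe (u : charMonoid σ) (x : CoordAlg K σ) : coef K σ u x = x.coeff u := by
  rw [coef_apply, incl, AddMonoidAlgebra.mapDomainAlgHom_apply, AddMonoidAlgebra.coeff_mapDomain]
  exact Finsupp.mapDomain_apply Subtype.val_injective _ _

theorem mem_of_coef_ne_zero {a : Lat} {x : CoordAlg K σ} (h : coef K σ a x ≠ 0) :
    a ∈ charMonoid σ := by
  by_contra ha
  apply h
  rw [coef_apply, incl, AddMonoidAlgebra.mapDomainAlgHom_apply, AddMonoidAlgebra.coeff_mapDomain]
  refine Finsupp.mapDomain_of_notMem_range _ _ ?_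
  rintro ⟨u, rfl⟩
  exact ha u.2

theorem ext_coef {x y : CoordAlg K σ} (h : ∀ a, coef K σ a x = coef K σ a y) : x = y := by
  apply AddMonoidAlgebra.coeff_injective
  ext u
  rw [← coef_coe, ← coef_coe, h]

theorem chi_injective {a b : charMonoid σ} (hab : chi K a = chi K b) : a = b := by
  have := coef_chi (K := K) b a
  rw [hab, coef_chi, if_pos rfl] at this
  by_contra hne
  rw [if_neg fun e => hne (Subtype.ext e)] at this
  exact one_ne_zero this

theorem chi_nsmul (n : ℕ) (u : charMonoid σ) : chi K (n • u) = chi K u ^ n := by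
  rw [chi, chi, AddMonoidAlgebra.single_pow, one_pow]

theorem eq_sum_chi (x : CoordAlg K σ) : x = ∑ u ∈ x.coeff.support, coef K σ u x • chi K u := by
  conv_lhs => rw [← AddMonoidAlgebra.sum_coeff_single x]
  refine Finset.sum_congr rfl fun u _ => ?_
  simp [coef_coe, chi]

/-- The coefficient of `χ^a ⊗ χ^b`, as a linear form on `K[Z_σ] ⊗ K[Z_σ]`. -/
noncomputable def coefTwo (K : Type*) [Field K] (σ : SurfaceCone) (a b : Lat) :
    CoordAlg K σ ⊗[K] CoordAlg K σ →ₗ[K] K :=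
  LinearMap.mul' K K ∘ₗ TensorProduct.map (coef K σ a) (coef K σ b)

theorem coefTwo_tmul (a b : Lat) (x y : CoordAlg K σ) :
    coefTwo K σ a b (x ⊗ₜ[K] y) = coef K σ a x * coef K σ b y := rfl

variable (D : DemazurePair σ)

theorem dotProduct_add_nsmul {p e : Lat} (he : e ⬝ᵥ p = -1) (v : Lat) (k : ℕ) :
    (v + k • e) ⬝ᵥ p = v ⬝ᵥ p - k := by
  rw [add_dotProduct, smul_dotProduct, he, nsmul_eq_mul]
  ring

theorem coefTwo_comulChar (a b : Lat) (u : charMonoid σ) :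
    coefTwo K σ a b (D.comulChar K u) = ∑ k : Fin (D.expo u + 1), ((D.expo u).choose k : K) *
      ((if (u : Lat) + (k : ℕ) • D.e₂ = a then 1 else 0) *
        (if (u : Lat) + (D.expo u - k) • D.e₁ = b then 1 else 0)) := by
  rw [DemazurePair.comulChar, map_sum]
  refine Finset.sum_congr rfl fun k _ => ?_
  rw [map_nsmul, coefTwo_tmul, coef_chi, coef_chi, nsmul_eq_mul]
  rfl

/-- The two exponents pair with `p` to `i` and `j`, so they determine `i`, `j` and then `v`: a
single binomial term of a single character contributes. -/
theorem coefTwo_comulHom (x : CoordAlg K σ) {v : Lat} {i j : ℕ} (hv : v ⬝ᵥ D.p = i + j) :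
    coefTwo K σ (v + j • D.e₂) (v + i • D.e₁) (D.comulHom K x) =
      (i + j).choose j * coef K σ v x := by
  suffices h : coefTwo K σ (v + j • D.e₂) (v + i • D.e₁) ∘ₗ (D.comulHom K).toLinearMap =
      ((i + j).choose j : K) • coef K σ v from LinearMap.congr_fun h x
  apply AddMonoidAlgebra.lhom_ext'
  intro u
  ext
  change coefTwo K σ _ _ (D.comulHom K (chi K u)) = (i + j).choose j * coef K σ v (chi K u)
  rw [comulHom_chi, coefTwo_comulChar, coef_chi]
  have hu := D.expo_cast u
  split_ifs with huv
  · have hm : D.expo u = i + j := by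
      rw [huv, hv] at hu
      exact_mod_cast hu
    rw [Finset.sum_eq_single ⟨j, by omega⟩]
    · simp [huv, hm]
    · intro k _ hk
      rw [if_neg, zero_mul, mul_zero]
      intro h
      apply hk
      have := congrArg (· ⬝ᵥ D.p) h
      simp only [dotProduct_add_nsmul D.root₂.pairing_eq, huv] at this
      ext
      simp only
      omega
    · simp
  · rw [mul_zero]
    refine Finset.sum_eq_zero fun k _ => ?_
    rw [ite_mul, one_mul, zero_mul]
    split_ifs with h1 h2
    · exfalso
      apply huv
      have e1 := congrArg (· ⬝ᵥ D.p) h1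
      have e2 := congrArg (· ⬝ᵥ D.p) h2
      simp only [dotProduct_add_nsmul D.root₂.pairing_eq,
        dotProduct_add_nsmul D.root₁.pairing_eq] at e1 e2
      -- The pairing of the right-hand exponent with `p` is `k` on one side and `j` on the other.
      have hkj : (k : ℕ) = j := by omega
      rw [hkj] at h1
      exact add_right_cancel h1
    · simp
    · simp

theorem exists_of_coefTwo_ne_zero {x : CoordAlg K σ} {a b : Lat}
    (h : coefTwo K σ a b (D.comulHom K x) ≠ 0) :
    ∃ (v : Lat) (i j : ℕ), v ⬝ᵥ D.p = i + j ∧ a = v + j • D.e₂ ∧ b = v + i • D.e₁ ∧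
      a ⬝ᵥ D.p = i ∧ b ⬝ᵥ D.p = j ∧ coef K σ v x ≠ 0 := by
  rw [eq_sum_chi x, map_sum, map_sum] at h
  obtain ⟨u, -, hu⟩ := Finset.exists_ne_zero_of_sum_ne_zero h
  rw [map_smul, map_smul, smul_eq_mul, comulHom_chi, coefTwo_comulChar] at hu
  obtain ⟨k, -, hk⟩ := Finset.exists_ne_zero_of_sum_ne_zero (right_ne_zero_of_mul hu)
  have hk' := right_ne_zero_of_mul hk
  have h1 : (u : Lat) + (k : ℕ) • D.e₂ = a := by
    by_contra h0
    rw [if_neg h0, zero_mul] at hk'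
    exact hk' rfl
  have h2 : (u : Lat) + (D.expo u - k) • D.e₁ = b := by
    by_contra h0
    rw [if_neg h0, mul_zero] at hk'
    exact hk' rfl
  have hu' := D.expo_cast u
  have hk2 := k.2
  refine ⟨u, D.expo u - k, k, by omega, h1.symm, h2.symm, ?_, ?_, left_ne_zero_of_mul hu⟩
  · rw [← h1, dotProduct_add_nsmul D.root₂.pairing_eq]
    omega
  · rw [← h2, dotProduct_add_nsmul D.root₁.pairing_eq]
    omega

theorem comulHom_chi_of_zero {u : charMonoid σ} (hu : (u : Lat) ⬝ᵥ D.p = 0) :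
    D.comulHom K (chi K u) = chi K u ⊗ₜ[K] chi K u := by
  have h : D.expo u = 0 := by rw [DemazurePair.expo, hu, Int.toNat_zero]
  apply inclTwo_injective
  rw [comulHom_chi, incl_comulChar, h, pow_zero, mul_one, Algebra.TensorProduct.map_tmul, incl_chi]

theorem comulHom_chi_of_one {u α β : charMonoid σ} (hu : (u : Lat) ⬝ᵥ D.p = 1)
    (hα : (α : Lat) = u + D.e₁) (hβ : (β : Lat) = u + D.e₂) :
    D.comulHom K (chi K u) = chi K u ⊗ₜ[K] chi K α + chi K β ⊗ₜ[K] chi K u := by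
  have h : D.expo u = 1 := by rw [DemazurePair.expo, hu, Int.toNat_one]
  apply inclTwo_injective
  rw [comulHom_chi, incl_comulChar, h, pow_one, map_add, Algebra.TensorProduct.map_tmul,
    Algebra.TensorProduct.map_tmul, incl_chi, incl_chi, incl_chi, hα, hβ, chiT_add, chiT_add,
    mul_add, Algebra.TensorProduct.tmul_mul_tmul, Algebra.TensorProduct.tmul_mul_tmul, mul_one]

/-- The group-like elements of the bialgebra are the characters that are constant along the
root subgroups. -/
theorem exists_eq_chi_of_comul {x : CoordAlg K σ} (hx : x ≠ 0)
    (h : D.comulHom K x = x ⊗ₜ[K] x) : ∃ a : charMonoid σ, (a : Lat) ⬝ᵥ D.p = 0 ∧ x = chi K a := by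
  have hcoef : ∀ a b, coefTwo K σ a b (D.comulHom K x) = coef K σ a x * coef K σ b x := fun a b => by
    rw [h, coefTwo_tmul]
  have hne : x.coeff.support.Nonempty := by
    rw [Finsupp.support_nonempty_iff]
    intro h0
    exact hx (AddMonoidAlgebra.coeff_injective h0)
  obtain ⟨a, ha, hmax⟩ := x.coeff.support.exists_max_image (fun u => (u : Lat) ⬝ᵥ D.p) hne
  rw [Finsupp.mem_support_iff, ← coef_coe] at ha
  -- `χ^a ⊗ χ^a` occurs in `x ⊗ x = Δ x`, so it comes from a character of `x` of degree `2⟨a, p⟩`;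
  -- the maximality of `⟨a, p⟩` leaves only 0.
  have ha0 : (a : Lat) ⬝ᵥ D.p = 0 := by
    obtain ⟨v, i, j, hv, -, -, hi, hj, hvx⟩ := exists_of_coefTwo_ne_zero D (x := x) (a := a)
      (b := a) (by rw [hcoef]; exact mul_ne_zero ha ha)
    have := hmax ⟨v, mem_of_coef_ne_zero hvx⟩
      (by rwa [Finsupp.mem_support_iff, ← coef_coe])
    simp only at this
    omega
  -- All degrees are now 0, where only diagonal terms `χ^v ⊗ χ^v` occur in the comultiplication.
  have huniq : ∀ b, coef K σ b x ≠ 0 → b = a := by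
    intro b hb
    have hb0 : b ⬝ᵥ D.p = 0 := by
      have hbS := mem_of_coef_ne_zero hb
      have h1 := hmax ⟨b, hbS⟩ (by rwa [Finsupp.mem_support_iff, ← coef_coe])
      have h2 := D.expo_cast ⟨b, hbS⟩
      simp only at h1 h2
      omega
    obtain ⟨v, i, j, hv, h1, h2, hi, hj, -⟩ := exists_of_coefTwo_ne_zero D (x := x) (a := a)
      (b := b) (by rw [hcoef]; exact mul_ne_zero ha hb)
    have hi0 : i = 0 := by omega
    have hj0 : j = 0 := by omega
    rw [h1, h2, hi0, hj0, zero_smul, zero_smul]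
  -- The coefficient `c ≠ 0` satisfies `c * c = c`.
  have hone : coef K σ a x = 1 := by
    have h1 := coefTwo_comulHom D x (v := a) (i := 0) (j := 0) (by simpa using ha0)
    rw [zero_smul, zero_smul, add_zero, hcoef] at h1
    simpa [ha] using h1
  refine ⟨a, ha0, ext_coef fun b => ?_⟩
  rw [coef_chi]
  split_ifs with hb
  · rw [← hb, hone]
  · by_contra h0
    exact hb (huniq b h0).symm

/-- Put `n = ⟨a, p⟩`. In characteristic zero every term `χ^{a+je₂} ⊗ χ^{a+ie₁}` with `i + j = n`
occurs in `Δ x`, so its right exponent is `α` or its left one is `β`. As `α` and `β` have degree 0,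
the first needs `j = 0` and the second `i = 0`. A splitting with both positive is thus impossible,
and `n = 1`. -/
theorem of_skewPrimitive [CharZero K] {x : CoordAlg K σ} {α β : charMonoid σ}
    (hα : (α : Lat) ⬝ᵥ D.p = 0) (hβ : (β : Lat) ⬝ᵥ D.p = 0)
    (h : D.comulHom K x = x ⊗ₜ[K] chi K α + chi K β ⊗ₜ[K] x) {a : Lat} (ha : coef K σ a x ≠ 0)
    (ha0 : a ⬝ᵥ D.p ≠ 0) : a ⬝ᵥ D.p = 1 ∧ a + D.e₁ = α ∧ a + D.e₂ = β := by
  have hcoef : ∀ a b, coefTwo K σ a b (D.comulHom K x) =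
      coef K σ a x * (if (α : Lat) = b then 1 else 0) +
        (if (β : Lat) = a then 1 else 0) * coef K σ b x := fun a b => by
    rw [h, map_add, coefTwo_tmul, coefTwo_tmul, coef_chi, coef_chi]
  obtain ⟨n, hn⟩ : ∃ n : ℕ, a ⬝ᵥ D.p = n :=
    ⟨_, (D.expo_cast ⟨a, mem_of_coef_ne_zero ha⟩).symm⟩
  have key : ∀ i j : ℕ, n = i + j →
      ((α : Lat) = a + i • D.e₁ ∨ (β : Lat) = a + j • D.e₂) := by
    intro i j hij
    have h1 := coefTwo_comulHom D x (v := a) (i := i) (j := j) (by rw [hn, hij]; push_cast; rfl)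
    rw [hcoef] at h1
    by_contra! h2
    rw [if_neg h2.1, if_neg h2.2, mul_zero, zero_mul, zero_add] at h1
    refine mul_ne_zero ?_ ha h1.symm
    exact_mod_cast (Nat.choose_pos (Nat.le_add_left j i)).ne'
  have degα : ∀ i : ℕ, (α : Lat) = a + i • D.e₁ → n = i := by
    intro i hi
    rw [hi, dotProduct_add_nsmul D.root₁.pairing_eq] at hα
    omega
  have degβ : ∀ j : ℕ, (β : Lat) = a + j • D.e₂ → n = j := by
    intro j hj
    rw [hj, dotProduct_add_nsmul D.root₂.pairing_eq] at hβ
    omega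
  have hn0 : n ≠ 0 := by
    rintro rfl
    exact ha0 hn
  have hn1 : n = 1 := by
    -- The first alternative would give `n = n - 1`, the second gives `n = 1`.
    rcases key (n - 1) 1 (by omega) with h | h
    · have := degα _ h
      omega
    · exact degβ _ h
  subst hn1
  refine ⟨hn, ?_, ?_⟩
  · rcases key 1 0 rfl with h | h
    · rw [h, one_smul]
    · exact absurd (degβ _ h) one_ne_zero
  · rcases key 0 1 rfl with h | h
    · exact absurd (degα _ h) one_ne_zero
    · rw [h, one_smul]

end Coefficients

/-! ### Leading terms -/

section Leading

variable {K : Type*} [Field K]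

/-- `χ^a` occurs in `f`, and every other character occurring in `f` pairs with `p` to a smaller
value. -/
def IsLeading (p : Lat) (f : TorusAlg K) (a : Lat) : Prop :=
  f.coeff a ≠ 0 ∧ ∀ b, f.coeff b ≠ 0 → b = a ∨ b ⬝ᵥ p < a ⬝ᵥ p

theorem isLeading_chiT (p a : Lat) : IsLeading p (chiT K a) a := by
  classical
  refine ⟨by simp [chiT], fun b hb => Or.inl ?_⟩
  by_contra h
  apply hb
  rw [chiT, AddMonoidAlgebra.coeff_single, Finsupp.single_apply, if_neg (Ne.symm h)]

/-- The top degree is attained once in each factor, so `a + b` arises in only one way and cannot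
cancel. -/
theorem IsLeading.mul {p : Lat} {f g : TorusAlg K} {a b : Lat} (hf : IsLeading p f a)
    (hg : IsLeading p g b) : IsLeading p (f * g) (a + b) := by
  classical
  have hu : UniqueAdd f.coeff.support g.coeff.support a b := by
    intro c d hc hd hcd
    rw [Finsupp.mem_support_iff] at hc hd
    have hs := congrArg (· ⬝ᵥ p) hcd
    simp only [add_dotProduct] at hs
    rcases hf.2 c hc with h1 | h1 <;> rcases hg.2 d hd with h2 | h2
    · exact ⟨h1, h2⟩
    · rw [h1] at hs
      omega
    · rw [h2] at hs
      omega
    · omega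
  refine ⟨?_, fun c hc => ?_⟩
  · rw [AddMonoidAlgebra.coeff_mul_add_of_uniqueAdd hu]
    exact mul_ne_zero hf.1 hg.1
  · have := AddMonoidAlgebra.support_coeff_mul_subset f g (Finsupp.mem_support_iff.2 hc)
    obtain ⟨x, hx, y, hy, rfl⟩ := Finset.mem_add.1 this
    rw [Finsupp.mem_support_iff] at hx hy
    rw [add_dotProduct, add_dotProduct]
    rcases hf.2 x hx with rfl | h1 <;> rcases hg.2 y hy with rfl | h2
    · exact Or.inl rfl
    all_goals right; omega

theorem IsLeading.pow {p : Lat} {f : TorusAlg K} {a : Lat} (hf : IsLeading p f a) (n : ℕ) :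
    IsLeading p (f ^ n) (n • a) := by
  induction n with
  | zero =>
    rw [pow_zero, zero_smul, ← chiT_zero]
    exact isLeading_chiT p 0
  | succ n ih =>
    rw [pow_succ, succ_nsmul]
    exact ih.mul hf

end Leading

/-! ### Isomorphisms induce symmetries of the cone -/

/-- The algebra automorphism `φ` of `K[Z_σ]` carries the comultiplication of `D` to that
of `D'`. -/
def Intertwines {K : Type*} [Field K] {σ : SurfaceCone} (φ : CoordAlg K σ ≃ₐ[K] CoordAlg K σ)
    (D D' : DemazurePair σ) : Prop :=
  ∀ x, Algebra.TensorProduct.map φ.toAlgHom φ.toAlgHom (D.comulHom K x) = D'.comulHom K (φ x)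

namespace Intertwines

variable {K : Type*} [Field K] {σ : SurfaceCone} {φ : CoordAlg K σ ≃ₐ[K] CoordAlg K σ}
  {D D' : DemazurePair σ} (h : Intertwines φ D D')

include h

theorem symm : Intertwines φ.symm D' D := by
  intro x
  obtain ⟨y, rfl⟩ := φ.surjective x
  rw [← h, φ.symm_apply_apply, ← AlgHom.comp_apply, ← Algebra.TensorProduct.map_comp]
  have e : φ.symm.toAlgHom.comp φ.toAlgHom = AlgHom.id K (CoordAlg K σ) :=
    AlgHom.ext fun z => φ.symm_apply_apply z
  rw [e, Algebra.TensorProduct.map_id, AlgHom.id_apply]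

/-- Group-like elements go to group-like elements. -/
theorem exists_map_chi_of_zero {a : charMonoid σ} (ha : (a : Lat) ⬝ᵥ D.p = 0) :
    ∃ a' : charMonoid σ, (a' : Lat) ⬝ᵥ D'.p = 0 ∧ φ (chi K a) = chi K a' := by
  apply exists_eq_chi_of_comul
  · rw [Ne, EmbeddingLike.map_eq_zero_iff]
    intro h0
    have := coef_chi (K := K) a a
    rw [h0, map_zero, if_pos rfl] at this
    exact zero_ne_one this
  · rw [← h, comulHom_chi_of_zero D ha]
    rfl

/-- Otherwise `φ(χ^u)` would be a combination of group-likes, and applying `φ⁻¹` would make `χ^u`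
one too. -/
theorem exists_coef_map_chi_ne_zero {u : charMonoid σ} (hu : (u : Lat) ⬝ᵥ D.p ≠ 0) :
    ∃ a, a ⬝ᵥ D'.p ≠ 0 ∧ coef K σ a (φ (chi K u)) ≠ 0 := by
  by_contra! h0
  have h1 : coef K σ u (φ.symm (φ (chi K u))) = 0 := by
    rw [eq_sum_chi (φ (chi K u)), map_sum, map_sum]
    refine Finset.sum_eq_zero fun a _ => ?_
    by_cases ha : (a : Lat) ⬝ᵥ D'.p = 0
    · obtain ⟨b, hb, hab⟩ := h.symm.exists_map_chi_of_zero ha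
      rw [map_smul, map_smul, hab, coef_chi, if_neg, smul_zero]
      intro hbu
      exact hu (hbu ▸ hb)
    · rw [h0 _ ha, zero_smul, map_zero, map_zero]
  rw [φ.symm_apply_apply, coef_chi, if_pos rfl] at h1
  exact one_ne_zero h1

/-- `χ^u` is skew-primitive between `χ^α` and `χ^β`, hence so is its image between `χ^{α'}` and
`χ^{β'}`. Any character of the image not orthogonal to `p'` has exponent `α' - e₁'`, so there is
only one. -/
theorem exists_isLeading [CharZero K] {u α β α' β' : charMonoid σ} (hu : (u : Lat) ⬝ᵥ D.p = 1)
    (hα : (α : Lat) = u + D.e₁) (hβ : (β : Lat) = u + D.e₂)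
    (hα₀ : (α' : Lat) ⬝ᵥ D'.p = 0) (hβ₀ : (β' : Lat) ⬝ᵥ D'.p = 0)
    (hαα' : φ (chi K α) = chi K α') (hββ' : φ (chi K β) = chi K β') :
    ∃ u' : Lat, IsLeading D'.p (incl K σ (φ (chi K u))) u' ∧
      u' + D'.e₁ = α' ∧ u' + D'.e₂ = β' := by
  have hcomul : D'.comulHom K (φ (chi K u)) =
      φ (chi K u) ⊗ₜ[K] chi K α' + chi K β' ⊗ₜ[K] φ (chi K u) := by
    rw [← h, comulHom_chi_of_one D hu hα hβ, map_add, ← hαα', ← hββ']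
    rfl
  obtain ⟨u', hu0, hu'⟩ := h.exists_coef_map_chi_ne_zero (u := u) (by rw [hu]; exact one_ne_zero)
  obtain ⟨h1, h2, h3⟩ := of_skewPrimitive D' hα₀ hβ₀ hcomul hu' hu0
  refine ⟨u', ⟨hu', fun b hb => ?_⟩, h2, h3⟩
  by_cases hb0 : b ⬝ᵥ D'.p = 0
  · right
    omega
  · left
    obtain ⟨-, h4, -⟩ := of_skewPrimitive D' hα₀ hβ₀ hcomul hb hb0
    exact add_right_cancel (h4.trans h2.symm)

/-- The linear map of `M` induced by a bialgebra isomorphism. -/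
theorem exists_matrix [CharZero K] : ∃ A : Matrix (Fin 2) (Fin 2) ℤ,
    (∀ u ∈ charMonoid σ, A.mulVec u ∈ charMonoid σ) ∧ A.mulVec D.e₁ = D'.e₁ ∧
    A.mulVec D.e₂ = D'.e₂ ∧ ∀ α : charMonoid σ, (α : Lat) ⬝ᵥ D.p = 0 →
      ∃ α' : charMonoid σ, (α' : Lat) = A.mulVec α ∧ (α' : Lat) ⬝ᵥ D'.p = 0 ∧
        φ (chi K α) = chi K α' := by
  have hp := D.root₁.isRayGenerator
  obtain ⟨q, hq, hqp⟩ := exists_ne_rayGenerator σ D.p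
  obtain ⟨w, hwp, hwq, hw⟩ := exists_edge hp hq hqp.symm
  have hmem : ∀ {u : Lat}, u ∈ charMonoid σ ↔ 0 ≤ u ⬝ᵥ D.p ∧ 0 ≤ u ⬝ᵥ q :=
    mem_charMonoid_iff_two hp hq hqp.symm
  obtain ⟨W, rfl⟩ : ∃ W : charMonoid σ, (W : Lat) = w := ⟨⟨w, hmem.2 ⟨hwp.ge, hwq.le⟩⟩, rfl⟩
  obtain ⟨W', hW'0, hWW'⟩ := h.exists_map_chi_of_zero hwp
  have hedge : ∀ α : charMonoid σ, (α : Lat) ⬝ᵥ D.p = 0 → ∃ n : ℕ, α = n • W := by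
    intro α hα
    obtain ⟨t, ht⟩ := hw α hα
    have h0 : 0 ≤ t := by
      have := (hmem.1 α.2).2
      rw [ht, smul_dotProduct, smul_eq_mul] at this
      exact nonneg_of_mul_nonneg_left this hwq
    lift t to ℕ using h0
    refine ⟨t, Subtype.ext ?_⟩
    rw [ht, natCast_zsmul]
    rfl
  -- `-e₁` pairs to 1 with `p`; adding multiples of `W` keeps this and makes the pairing with `q`
  -- nonnegative, since `⟨W, q⟩ ≥ 1`.
  obtain ⟨U, hU⟩ : ∃ U : charMonoid σ, (U : Lat) = -D.e₁ + (D.e₁ ⬝ᵥ q).toNat • (W : Lat) := by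
    refine ⟨⟨_, hmem.2 ⟨?_, ?_⟩⟩, rfl⟩
    · rw [add_dotProduct, smul_dotProduct, neg_dotProduct, hwp, D.root₁.pairing_eq]
      simp
    · rw [add_dotProduct, smul_dotProduct, neg_dotProduct, nsmul_eq_mul]
      have h1 := Int.self_le_toNat (D.e₁ ⬝ᵥ q)
      have h2 : ((D.e₁ ⬝ᵥ q).toNat : ℤ) * 1 ≤ (D.e₁ ⬝ᵥ q).toNat * ((W : Lat) ⬝ᵥ q) :=
        mul_le_mul_of_nonneg_left hwq (Int.natCast_nonneg _)
      omega
  have hUp : (U : Lat) ⬝ᵥ D.p = 1 := by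
    rw [hU, add_dotProduct, smul_dotProduct, neg_dotProduct, hwp, D.root₁.pairing_eq]
    simp
  have hroot : ∀ {e : Lat}, IsDemazureRoot σ D.p e →
      ∃ α : charMonoid σ, (α : Lat) = U + e ∧ (α : Lat) ⬝ᵥ D.p = 0 := by
    intro e he
    refine ⟨⟨_, ?_⟩, rfl, ?_⟩
    · simpa using D.add_smul_mem he U (k := 1) (by
        have := D.expo_cast U
        omega)
    · rw [add_dotProduct, hUp, he.pairing_eq]
      rfl
  obtain ⟨α, hα, hα0⟩ := hroot D.root₁
  obtain ⟨β, hβ, hβ0⟩ := hroot D.root₂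
  obtain ⟨α', hα'0, hαα'⟩ := h.exists_map_chi_of_zero hα0
  obtain ⟨β', hβ'0, hββ'⟩ := h.exists_map_chi_of_zero hβ0
  obtain ⟨u', hlead, hu1, hu2⟩ := h.exists_isLeading hUp hα hβ hα'0 hβ'0 hαα' hββ'
  -- As `⟨U, p⟩ = 1` and `W` generates `p^⊥`, the two form a basis of `M`. The coordinates are
  -- pairing with `p` and with the vector `T` read off on the standard basis.
  have hcoord : ∀ j, ∃ t : ℤ, Pi.single j 1 = D.p j • (U : Lat) + t • (W : Lat) := by
    intro j
    obtain ⟨t, ht⟩ := hw (Pi.single j 1 - D.p j • (U : Lat)) (by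
      rw [sub_dotProduct, smul_dotProduct, hUp, single_one_dotProduct]
      simp)
    exact ⟨t, by rw [← ht, add_sub_cancel]⟩
  choose T hT using hcoord
  have hdec : ∀ v : Lat, v = (v ⬝ᵥ D.p) • (U : Lat) + (v ⬝ᵥ T) • (W : Lat) := by
    intro v
    have e : v = v 0 • Pi.single 0 1 + v 1 • Pi.single 1 1 := by
      ext i
      fin_cases i <;> simp
    conv_lhs => rw [e, hT, hT]
    simp only [dotProduct, Fin.sum_univ_two, smul_add, add_smul, smul_smul]
    abel
  have hW0 : (W : Lat) ≠ 0 := by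
    intro h0
    rw [h0, zero_dotProduct] at hwq
    exact lt_irrefl _ hwq
  have hUT : (U : Lat) ⬝ᵥ T = 0 := by
    have := hdec U
    rw [hUp, one_smul, left_eq_add, smul_eq_zero] at this
    exact this.resolve_right hW0
  have hWT : (W : Lat) ⬝ᵥ T = 1 := by
    have := hdec W
    rw [hwp, zero_smul, zero_add] at this
    have h1 : ((W : Lat) ⬝ᵥ T - 1) • (W : Lat) = 0 := by
      rw [sub_smul, ← this, one_smul, sub_self]
    exact sub_eq_zero.1 ((smul_eq_zero.1 h1).resolve_right hW0)
  -- The matrix of the linear map `U ↦ u'`, `W ↦ W'`.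
  let A : Matrix (Fin 2) (Fin 2) ℤ := Matrix.of fun i j => D.p j * u' i + T j * (W' : Lat) i
  have hA : ∀ v : Lat, A.mulVec v = (v ⬝ᵥ D.p) • u' + (v ⬝ᵥ T) • (W' : Lat) := by
    intro v
    ext i
    simp only [A, Matrix.mulVec, dotProduct, Fin.sum_univ_two, Matrix.of_apply, Pi.add_apply,
      Pi.smul_apply, smul_eq_mul]
    ring
  have hAU : A.mulVec U = u' := by rw [hA, hUp, hUT, one_smul, zero_smul, add_zero]
  have hAzero : ∀ α : charMonoid σ, (α : Lat) ⬝ᵥ D.p = 0 →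
      ∃ α' : charMonoid σ, (α' : Lat) = A.mulVec α ∧ (α' : Lat) ⬝ᵥ D'.p = 0 ∧
        φ (chi K α) = chi K α' := by
    intro α hα
    obtain ⟨n, rfl⟩ := hedge α hα
    refine ⟨n • W', ?_, ?_, ?_⟩
    · rw [hA, hα, zero_smul, zero_add, AddSubmonoidClass.coe_nsmul, AddSubmonoidClass.coe_nsmul,
        smul_dotProduct, hWT]
      simp
    · rw [AddSubmonoidClass.coe_nsmul, smul_dotProduct, hW'0, smul_zero]
    · rw [chi_nsmul, chi_nsmul, map_pow, hWW']
  have hAe : ∀ {e e' : Lat} {α α' : charMonoid σ}, (α : Lat) = U + e → (α : Lat) ⬝ᵥ D.p = 0 →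
      φ (chi K α) = chi K α' → u' + e' = α' → A.mulVec e = e' := by
    intro e e' α α' hα hα0 hαα' hu'
    obtain ⟨γ, hγ, -, hγ'⟩ := hAzero α hα0
    rw [← chi_injective (hαα'.symm.trans hγ'), hα, Matrix.mulVec_add, hAU, ← hu'] at hγ
    exact (add_left_cancel hγ).symm
  refine ⟨A, fun v hv => ?_, hAe hα hα0 hαα' hu1, hAe hβ hβ0 hββ' hu2, hAzero⟩
  obtain ⟨V, rfl⟩ : ∃ V : charMonoid σ, (V : Lat) = v := ⟨⟨v, hv⟩, rfl⟩
  -- The `W`-coordinate of `V` may be negative; written as a difference of naturals, it gives a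
  -- relation inside `σ^∨ ∩ M`, to which `φ` applies.
  obtain ⟨m, n, hmn⟩ : ∃ m n : ℕ, (V : Lat) ⬝ᵥ T = m - n :=
    ⟨((V : Lat) ⬝ᵥ T).toNat, (-((V : Lat) ⬝ᵥ T)).toNat, (Int.toNat_sub_toNat_neg _).symm⟩
  have hV : V + n • W = D.expo V • U + m • W := by
    apply Subtype.ext
    simp only [AddSubmonoid.coe_add, AddSubmonoidClass.coe_nsmul, ← natCast_zsmul]
    conv_lhs => rw [hdec V, ← D.expo_cast, hmn, sub_smul]
    abel
  have hΦ : incl K σ (φ (chi K V)) * chiT K (W' : Lat) ^ n =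
      incl K σ (φ (chi K U)) ^ D.expo V * chiT K (W' : Lat) ^ m := by
    have := congrArg (fun x => incl K σ (φ (chi K x))) hV
    simpa only [chi_add, chi_nsmul, map_mul, map_pow, hWW', incl_chi] using this
  -- In `K[M]` the character of `W'` is invertible, so the relation can be solved for `φ(χ^V)` and
  -- its leading exponent read off.
  have hinv : chiT K (W' : Lat) ^ n * chiT K (n • -(W' : Lat)) = 1 := by
    rw [← chiT_nsmul, ← chiT_add, smul_neg, add_neg_cancel, chiT_zero]
  have hVlead : IsLeading D'.p (incl K σ (φ (chi K V)))
      (D.expo V • u' + m • (W' : Lat) + n • -(W' : Lat)) := by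
    have e : incl K σ (φ (chi K V)) = incl K σ (φ (chi K U)) ^ D.expo V * chiT K (W' : Lat) ^ m *
        chiT K (n • -(W' : Lat)) := by
      rw [← hΦ, mul_assoc, hinv, mul_one]
    rw [e]
    exact ((hlead.pow _).mul ((isLeading_chiT _ _).pow _)).mul (isLeading_chiT _ _)
  have hVA : A.mulVec V = D.expo V • u' + m • (W' : Lat) + n • -(W' : Lat) := by
    rw [hA, hmn, ← D.expo_cast, sub_smul, natCast_zsmul, natCast_zsmul, natCast_zsmul, smul_neg]
    abel
  rw [hVA]
  -- `A V` is an exponent occurring in an element of `K[Z_σ]`.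
  exact mem_of_coef_ne_zero (K := K) hVlead.1

omit h in
-- `M` is generated by `e₁` and the edge vector `w` spanning `p^⊥`, and `B * A` fixes both; on `w`
-- this is because `φ` and `φ⁻¹` cancel on the group-like `χ^w`.
theorem mul_eq_one {A B : Matrix (Fin 2) (Fin 2) ℤ} (hA : A.mulVec D.e₁ = D'.e₁)
    (hB : B.mulVec D'.e₁ = D.e₁)
    (hA₀ : ∀ α : charMonoid σ, (α : Lat) ⬝ᵥ D.p = 0 → ∃ α' : charMonoid σ,
      (α' : Lat) = A.mulVec α ∧ (α' : Lat) ⬝ᵥ D'.p = 0 ∧ φ (chi K α) = chi K α')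
    (hB₀ : ∀ α : charMonoid σ, (α : Lat) ⬝ᵥ D'.p = 0 → ∃ α' : charMonoid σ,
      (α' : Lat) = B.mulVec α ∧ (α' : Lat) ⬝ᵥ D.p = 0 ∧ φ.symm (chi K α) = chi K α') :
    B * A = 1 := by
  have hp := D.root₁.isRayGenerator
  obtain ⟨q, hq, hqp⟩ := exists_ne_rayGenerator σ D.p
  obtain ⟨w, hwp, hwq, hw⟩ := exists_edge hp hq hqp.symm
  have hwS : w ∈ charMonoid σ := (mem_charMonoid_iff_two hp hq hqp.symm).2 ⟨hwp.ge, hwq.le⟩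
  have hBw : B.mulVec (A.mulVec w) = w := by
    obtain ⟨α, hα, hα0, hαφ⟩ := hA₀ ⟨w, hwS⟩ hwp
    obtain ⟨β, hβ, -, hβφ⟩ := hB₀ α hα0
    rw [← hαφ, φ.symm_apply_apply] at hβφ
    rw [← hα, ← hβ, ← chi_injective hβφ]
  apply Matrix.mulVec_injective
  funext v
  rw [Matrix.one_mulVec, ← Matrix.mulVec_mulVec]
  obtain ⟨t, ht⟩ := hw (v + (v ⬝ᵥ D.p) • D.e₁) (by
    rw [add_dotProduct, smul_dotProduct, D.root₁.pairing_eq]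
    simp)
  rw [← eq_sub_iff_add_eq] at ht
  rw [ht, Matrix.mulVec_sub, Matrix.mulVec_sub, Matrix.mulVec_smul, Matrix.mulVec_smul,
    Matrix.mulVec_smul, Matrix.mulVec_smul, hBw, hA, hB]

end Intertwines

theorem IsoMonoids.exists_isSymmetry {K : Type*} [Field K] [CharZero K] {σ : SurfaceCone}
    {D D' : DemazurePair σ} (hD : IsoMonoids K D D') : ∃ A B : Matrix (Fin 2) (Fin 2) ℤ,
    IsSymmetry σ A B ∧ A.mulVec D.e₁ = D'.e₁ ∧ A.mulVec D.e₂ = D'.e₂ := by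
  obtain ⟨φ, hφ⟩ := hD.exists_algEquiv
  have h : Intertwines φ D D' := hφ
  obtain ⟨A, hA, hA1, hA2, hA0⟩ := h.exists_matrix
  obtain ⟨B, hB, hB1, hB2, hB0⟩ := h.symm.exists_matrix
  have hBA : B * A = 1 := Intertwines.mul_eq_one hA1 hB1 hA0 hB0
  exact ⟨A, B, ⟨mul_eq_one_comm.1 hBA, hBA, hA, hB⟩, hA1, hA2⟩

/-! ### The symmetries of the cone -/

theorem linearMap_ext_of_cross {f g : LatQ →ₗ[ℚ] LatQ} {x y : LatQ} (hxy : cross x y ≠ 0)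
    (hx : f x = g x) (hy : f y = g y) : f = g := by
  refine LinearMap.ext fun z => ?_
  have h : ∀ f : LatQ →ₗ[ℚ] LatQ, cross x y • f z = cross z y • f x + cross x z • f y := by
    intro f
    rw [← map_smul, cross_smul_eq, map_add, map_smul, map_smul]
  refine smul_right_injective _ hxy ?_
  simp only [h, hx, hy]

section Swap

variable {σ : SurfaceCone} {v₁ v₂ : Lat} (hv₁ : IsRayGenerator (dualCone σ.cone) v₁)
  (hv₂ : IsRayGenerator (dualCone σ.cone) v₂) (hv : v₁ ≠ v₂) {τ : LatQ →ₗ[ℚ] LatQ}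
  (hτ₁ : τ (toQ v₁) = toQ v₂) (hτ₂ : τ (toQ v₂) = toQ v₁)

include hv₁ hv₂ hv hτ₁ hτ₂

/-- A symmetry of the cone is the identity or swaps the two edges of the dual cone. -/
theorem IsSymmetry.eq_id_or_eq_swap {A B : Matrix (Fin 2) (Fin 2) ℤ} (h : IsSymmetry σ A B) :
    matQ A = LinearMap.id ∨ matQ A = τ := by
  have hs := salient_dualCone σ
  have hd := cross_ne_zero hs hv₁ hv₂ hv
  have hne : A.mulVec v₁ ≠ A.mulVec v₂ := by
    intro h0
    apply hv
    have := congrArg B.mulVec h0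
    rwa [Matrix.mulVec_mulVec, Matrix.mulVec_mulVec, h.mul_eq', Matrix.one_mulVec,
      Matrix.one_mulVec] at this
  rcases eq_or_eq_of_isRayGenerator hs hv₁ hv₂ hv (h.dualCone_rayGenerator hv₁) with h1 | h1 <;>
  rcases eq_or_eq_of_isRayGenerator hs hv₁ hv₂ hv (h.dualCone_rayGenerator hv₂) with h2 | h2
  · exact absurd (h1.trans h2.symm) hne
  · left
    apply linearMap_ext_of_cross hd
    · rw [matQ_toQ, h1, LinearMap.id_apply]
    · rw [matQ_toQ, h2, LinearMap.id_apply]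
  · right
    apply linearMap_ext_of_cross hd
    · rw [matQ_toQ, h1, hτ₁]
    · rw [matQ_toQ, h2, hτ₂]
  · exact absurd (h1.trans h2.symm) hne

theorem swap_swap (x : LatQ) : τ (τ x) = x := by
  have h : τ ∘ₗ τ = LinearMap.id := by
    apply linearMap_ext_of_cross (cross_ne_zero (salient_dualCone σ) hv₁ hv₂ hv)
    · rw [LinearMap.comp_apply, hτ₁, hτ₂, LinearMap.id_apply]
    · rw [LinearMap.comp_apply, hτ₂, hτ₁, LinearMap.id_apply]
  exact LinearMap.congr_fun h x

theorem mul_self_eq_one_of_matQ_eq_swap {A : Matrix (Fin 2) (Fin 2) ℤ} (hA : matQ A = τ) :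
    A * A = 1 := by
  apply Matrix.mulVec_injective
  funext u
  apply toQ_injective
  rw [← Matrix.mulVec_mulVec, ← matQ_toQ, ← matQ_toQ, hA, swap_swap hv₁ hv₂ hv hτ₁ hτ₂,
    Matrix.one_mulVec]

/-- If the swap preserves the lattice, then it is a symmetry of the cone. -/
theorem exists_isSymmetry_swap (hτ : τ '' Set.range toQ = Set.range toQ) :
    ∃ A, IsSymmetry σ A A ∧ matQ A = τ := by
  have hex : ∀ u : Lat, ∃ u' : Lat, toQ u' = τ (toQ u) := fun u => by
    have : τ (toQ u) ∈ Set.range toQ := hτ ▸ ⟨_, ⟨u, rfl⟩, rfl⟩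
    exact this
  choose c hc using fun j : Fin 2 => hex (Pi.single j 1)
  let A : Matrix (Fin 2) (Fin 2) ℤ := Matrix.of fun i j => c j i
  have hA : matQ A = τ := by
    have hcol : ∀ j, matQ A (toQ (Pi.single j 1)) = τ (toQ (Pi.single j 1)) := by
      intro j
      rw [matQ_toQ, ← hc, Matrix.mulVec_single_one]
      rfl
    apply linearMap_ext_of_cross _ (hcol 0) (hcol 1)
    simp [cross, toQ_apply]
  have hAA : A * A = 1 := mul_self_eq_one_of_matQ_eq_swap hv₁ hv₂ hv hτ₁ hτ₂ hA
  have hS : ∀ u ∈ charMonoid σ, A.mulVec u ∈ charMonoid σ := by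
    intro u hu
    change toQ (A.mulVec u) ∈ dualCone σ.cone
    obtain ⟨a, b, ha, hb, hab⟩ := exists_coords (salient_dualCone σ) hv₁ hv₂ hv
      (show toQ u ∈ dualCone σ.cone from hu)
    rw [← matQ_toQ, hA, hab, map_add, map_smul, map_smul, hτ₁, hτ₂]
    exact Submodule.add_mem _ (PointedCone.smul_mem _ ha hv₂.mem)
      (PointedCone.smul_mem _ hb hv₁.mem)
  exact ⟨A, ⟨hAA, hAA, hS, hS⟩, hA⟩

end Swap

theorem IsSymmetry.one (σ : SurfaceCone) : IsSymmetry σ 1 1 :=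
  ⟨mul_one 1, mul_one 1, fun u hu => by rwa [Matrix.one_mulVec],
    fun u hu => by rwa [Matrix.one_mulVec]⟩

end ToricSurface

/-! ### The classification of the monoid structures. -/

theorem mainTheorem9 (K : Type*) [Field K] [IsAlgClosed K] [CharZero K]
    (σ : ToricSurface.SurfaceCone) (v₁ v₂ : ToricSurface.Lat)
    (hv₁ : ToricSurface.IsRayGenerator (ToricSurface.dualCone σ.cone) v₁)
    (hv₂ : ToricSurface.IsRayGenerator (ToricSurface.dualCone σ.cone) v₂)
    (hv : v₁ ≠ v₂)
    (τ : ToricSurface.LatQ →ₗ[ℚ] ToricSurface.LatQ)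
    (hτ₁ : τ (ToricSurface.toQ v₁) = ToricSurface.toQ v₂)
    (hτ₂ : τ (ToricSurface.toQ v₂) = ToricSurface.toQ v₁) :
    (τ '' Set.range ToricSurface.toQ ≠ Set.range ToricSurface.toQ →
      ∀ D D' : ToricSurface.DemazurePair σ,
        ToricSurface.IsoMonoids K D D' → D.e₁ = D'.e₁ ∧ D.e₂ = D'.e₂) ∧
    (τ '' Set.range ToricSurface.toQ = Set.range ToricSurface.toQ →
      (∀ D : ToricSurface.DemazurePair σ, ∃ D' : ToricSurface.DemazurePair σ,
        ToricSurface.toQ D'.e₁ = τ (ToricSurface.toQ D.e₁) ∧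
        ToricSurface.toQ D'.e₂ = τ (ToricSurface.toQ D.e₂)) ∧
      ∀ D D' : ToricSurface.DemazurePair σ,
        ToricSurface.IsoMonoids K D D' ↔
          (D.e₁ = D'.e₁ ∧ D.e₂ = D'.e₂) ∨
          (ToricSurface.toQ D'.e₁ = τ (ToricSurface.toQ D.e₁) ∧
           ToricSurface.toQ D'.e₂ = τ (ToricSurface.toQ D.e₂))) := by
  open ToricSurface in
  have hiso : ∀ D D' : DemazurePair σ, IsoMonoids K D D' →
      (D.e₁ = D'.e₁ ∧ D.e₂ = D'.e₂) ∨ ∃ A : Matrix (Fin 2) (Fin 2) ℤ, A * A = 1 ∧ matQ A = τ ∧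
        A.mulVec D.e₁ = D'.e₁ ∧ A.mulVec D.e₂ = D'.e₂ := by
    intro D D' h
    obtain ⟨A, B, hAB, h1, h2⟩ := h.exists_isSymmetry
    rcases hAB.eq_id_or_eq_swap hv₁ hv₂ hv hτ₁ hτ₂ with hA | hA
    · left
      rw [← h1, ← h2]
      constructor <;>
      · apply toQ_injective
        rw [← matQ_toQ, hA, LinearMap.id_apply]
    · exact Or.inr ⟨A, mul_self_eq_one_of_matQ_eq_swap hv₁ hv₂ hv hτ₁ hτ₂ hA, hA, h1, h2⟩
  open ToricSurface in
  refine ⟨fun hτ D D' h => ?_, fun hτ => ⟨fun D => ?_, fun D D' => ⟨fun h => ?_, ?_⟩⟩⟩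
  · refine (hiso D D' h).resolve_right ?_
    -- A swap given by an integral matrix of square 1 would map `M` onto itself.
    rintro ⟨A, hAA, rfl, -, -⟩
    apply hτ
    ext x
    constructor
    · rintro ⟨_, ⟨u, rfl⟩, rfl⟩
      exact ⟨_, (matQ_toQ A u).symm⟩
    · rintro ⟨u, rfl⟩
      exact ⟨_, ⟨_, rfl⟩, by rw [← matQ_toQ, matQ_matQ hAA]⟩
  · obtain ⟨A, hA, rfl⟩ := exists_isSymmetry_swap hv₁ hv₂ hv hτ₁ hτ₂ hτ
    exact ⟨hA.mapPair D, (matQ_toQ _ _).symm, (matQ_toQ _ _).symm⟩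
  · refine (hiso D D' h).imp_right ?_
    rintro ⟨A, -, rfl, h1, h2⟩
    rw [matQ_toQ, matQ_toQ, h1, h2]
    exact ⟨rfl, rfl⟩
  · rintro (⟨h1, h2⟩ | ⟨h1, h2⟩)
    · exact (IsSymmetry.one σ).isoMonoids K (by rw [Matrix.one_mulVec, h1])
        (by rw [Matrix.one_mulVec, h2])
    · obtain ⟨A, hA, rfl⟩ := exists_isSymmetry_swap hv₁ hv₂ hv hτ₁ hτ₂ hτ
      rw [matQ_toQ] at h1 h2
      exact hA.isoMonoids K (toQ_injective h1).symm (toQ_injective h2).symm
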